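/- Let $n\ge 3$ be odd, let $\Bbbk$ be an algebraically closed field of characteristic $0$, and let $q\in\Bbbk$ be a primitive $n$th root of unity. Let $\mathsf D_n$ be the Drinfeld double of the Taft algebra: the $\Bbbk$-algebra with generators $a,b,c,d$ and relations $$ba=qab,\quad db=qbd,\quad ca=qac,\quad dc=qcd,\quad bc=cb,\quad da-qad=1-bc,\quad a^n=d^n=0,\quad b^n=c^n=1,$$ with coproduct $\Delta(a)=a\otimes b+1\otimes a$, $\Delta(d)=d\otimes c+1\otimes d$, $\Delta(b)=b\otimes b$, $\Delta(c)=c\otimes c$. For $1\le \ell\le n$ and $r\in\mathbb Z_n=\mathbb Z/n\mathbb Z$ let $\mathsf V(\ell,r)$ be the simple $\mathsf D_n$-module with basis $v_1,\dots,v_\ell$ and action $$a.v_j=v_{j+1}\ (j<\ell),\quad a.v_\ell=0,\quad b.v_j=q^{r+j-1}v_j,\quad c.v_j=q^{j-(r+\ell)}v_j,\quad d.v_j=\alpha_{j-1}(\ell)v_{j-1}\ (j>1),\quad d.v_1=0,$$ where $\alpha_i(\ell)=\frac{(q^i-1)(1-q^{i-\ell})}{q-1}$. Let $\mathsf V=\mathsf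 V(2,0)$ and let $\mathsf M_{\mathsf V}$ be its McKay matrix: the $n^2\times n^2$ matrix (regarded over $\Bbbk$) with rows and columns indexed by the pairs $(\ell,r)$ in lexicographic order, whose $((\ell,r),(\ell',s))$ entry is the multiplicity $[\mathsf V(\ell,r)\otimes\mathsf V:\mathsf V(\ell',s)]$ of $\mathsf V(\ell',s)$ as a composition factor of $\mathsf V(\ell,r)\otimes\mathsf V$. Let $\mathrm Z$ be the $n\times n$ cyclic permutation matrix with entry $1$ in the positions $(s,s+1)$, $s\in\mathbb Z_n$, and $0$ elsewhere. Then in $n\times n$ blocks $$\mathsf M_{\mathsf V}=\begin{pmatrix}0&\mathrm I&0&\cdots&0&0\\ \mathrm Z&0&\mathrm I&\cdots&0&0\\ 0&\mathrm Z&0&\ddots&&\vdots\\ \vdots&&\ddots&\ddots&\mathrm I&0\\ 0&0&\cdots&\mathrm Z&0&\mathrm I\\ 2\mathrm I&0&\cdots&0&2\mathrm Z&0\end{pmatrix}.$$ Define polynomials by $\mathcal L_0=2$, $\mathcal L_1=t$, $\mathcal L_k=t\mathcal L_{k-1}-\mathcal L_{k-2}$ and $\mathcal U_0=1$, $\mathcal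 U_1=t$, $\mathcal U_k=t\,\mathcal U_{k-1}-\mathcal U_{k-2}$ for $k\ge2$. Let $r\in\mathbb Z_n$, let $\mathbf w_0\in\Bbbk^n$ be a left eigenvector of $\mathrm Z$ with eigenvalue $q^{2r}$ (so $\mathbf w_0\ne\mathbf 0$ and $\mathbf w_0\mathrm Z=q^{2r}\mathbf w_0$), and put $\lambda_{j,r}=q^r(q^j+q^{-j})$. (a) Let $0\le j\le\frac{n-1}2$ and set $\mathbf w_k=q^{kr}\mathcal L_k(q^j+q^{-j})\,\mathbf w_0$ for $1\le k\le n-1$. Then $\mathbf w_k=q^{kr}(q^{kj}+q^{-kj})\,\mathbf w_0$ for $1\le k\le n-1$, and $\mathbf w_{j,r}=[\mathbf w_{n-1}\ \mathbf w_{n-2}\ \cdots\ \mathbf w_1\ \mathbf w_0]$ is a left eigenvector of $\mathsf M_{\mathsf V}$ with eigenvalue $\lambda_{j,r}$. (b) Let $1\le j\le\frac{n-1}2$, write $\mathcal U_k=\mathcal U_k(q^j+q^{-j})$, and set $\mathbf y_0=\mathbf w_0$, $\mathbf y_1=q^r\mathcal U_1\mathbf w_0+\mathbf w_0$, and $$\mathbf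 y_k=q^{kr}(\mathcal U_k-\mathcal U_{k-2})\mathbf w_0+k\,q^{(k-1)r}\,\mathcal U_{k-1}\mathbf w_0\qquad(2\le k\le n-1).$$ Then $\mathbf y_{j,r}=[\mathbf y_{n-1}\ \mathbf y_{n-2}\ \cdots\ \mathbf y_1\ \mathbf y_0]$ is a generalized left eigenvector of $\mathsf M_{\mathsf V}$ with eigenvalue $\lambda_{j,r}$, that is, $\mathbf y_{j,r}(\mathsf M_{\mathsf V}-\lambda_{j,r}\mathrm I)$ is a (nonzero) left eigenvector of $\mathsf M_{\mathsf V}$ with eigenvalue $\lambda_{j,r}$; moreover $$\mathbf y_{j,r}\mathsf M_{\mathsf V}=\lambda_{j,r}\mathbf y_{j,r}+\mathbf w_{j,r}.$$ -/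

import Mathlib

open scoped TensorProduct Matrix

namespace TaftDouble

/-! ### Composition multiplicities -/

section Multiplicity

variable {A M : Type*} [Ring A] [AddCommGroup M] [Module A M]

/-- The number of factors of the composition series `s` that are isomorphic to `S`. -/
noncomputable def factorCount (S : Type*) [AddCommGroup S] [Module A S]
    (s : CompositionSeries (Submodule A M)) : ℕ :=
  Nat.card {i : Fin s.length //
    Nonempty ((s i.succ ⧸ (s i.castSucc).comap (s i.succ).subtype) ≃ₗ[A] S)}

/-- The number of factors isomorphic to `S` is the same for any two composition series. -/
theorem factorCount_eq (S : Type*) [AddCommGroup S] [Module A S]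
    (s t : CompositionSeries (Submodule A M)) (hh : s.head = t.head) (hl : s.last = t.last) :
    factorCount S s = factorCount S t := by
  obtain ⟨f, hf⟩ := CompositionSeries.jordan_holder s t hh hl
  refine Nat.card_congr (f.subtypeEquiv fun i => ?_)
  have e := (hf i).linearEquiv
  exact ⟨fun ⟨g⟩ => ⟨e.symm.trans g⟩, fun ⟨g⟩ => ⟨e.trans g⟩⟩

variable (A M) in
open Classical in
/-- The multiplicity `[M : S]` of `S` as a composition factor of the `A`-module `M`, computed from
any composition series of `M` (and `0` if `M` has none, i.e. if `M` has infinite length). -/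
noncomputable def compMult (S : Type*) [AddCommGroup S] [Module A S] : ℕ :=
  if h : ∃ s : CompositionSeries (Submodule A M), s.head = ⊥ ∧ s.last = ⊤ then
    factorCount S h.choose
  else 0

theorem compMult_eq (S : Type*) [AddCommGroup S] [Module A S]
    (s : CompositionSeries (Submodule A M)) (hh : s.head = ⊥) (hl : s.last = ⊤) :
    compMult A M S = factorCount S s := by
  have h : ∃ s : CompositionSeries (Submodule A M), s.head = ⊥ ∧ s.last = ⊤ := ⟨s, hh, hl⟩
  rw [compMult, dif_pos h]
  exact factorCount_eq S _ _ (h.choose_spec.1.trans hh.symm) (h.choose_spec.2.trans hl.symm)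

end Multiplicity

/-- The `A`-module attached to a representation `ρ : A → End V`: the space `V` with
`x • v = ρ x v`. -/
def RepModule {k A V : Type*} [Field k] [Ring A] [Algebra k A] [AddCommGroup V] [Module k V]
    (_ρ : A →ₐ[k] Module.End k V) : Type _ := V

instance {k A V : Type*} [Field k] [Ring A] [Algebra k A] [AddCommGroup V] [Module k V]
    (ρ : A →ₐ[k] Module.End k V) : AddCommGroup (RepModule ρ) :=
  inferInstanceAs (AddCommGroup V)

instance {k A V : Type*} [Field k] [Ring A] [Algebra k A] [AddCommGroup V] [Module k V]
    (ρ : A →ₐ[k] Module.End k V) : Module A (RepModule ρ) :=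
  letI : AddCommGroup (RepModule ρ) := inferInstanceAs (AddCommGroup V)
  Module.compHom V (ρ : A →+* Module.End k V)

/-! ### The Drinfeld double of the Taft algebra -/

/-- The four generators. -/
inductive Gen
  | a | b | c | d

open FreeAlgebra in
/-- The defining relations. -/
inductive Rel (k : Type*) [Field k] (n : ℕ) (q : k) :
    FreeAlgebra k Gen → FreeAlgebra k Gen → Prop
  | ba : Rel k n q (ι k Gen.b * ι k Gen.a) (q • (ι k Gen.a * ι k Gen.b))
  | db : Rel k n q (ι k Gen.d * ι k Gen.b) (q • (ι k Gen.b * ι k Gen.d))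
  | ca : Rel k n q (ι k Gen.c * ι k Gen.a) (q • (ι k Gen.a * ι k Gen.c))
  | dc : Rel k n q (ι k Gen.d * ι k Gen.c) (q • (ι k Gen.c * ι k Gen.d))
  | bc : Rel k n q (ι k Gen.b * ι k Gen.c) (ι k Gen.c * ι k Gen.b)
  | da : Rel k n q (ι k Gen.d * ι k Gen.a - q • (ι k Gen.a * ι k Gen.d))
      (1 - ι k Gen.b * ι k Gen.c)
  | an : Rel k n q (ι k Gen.a ^ n) 0
  | dn : Rel k n q (ι k Gen.d ^ n) 0
  | bn : Rel k n q (ι k Gen.b ^ n) 1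
  | cn : Rel k n q (ι k Gen.c ^ n) 1

/-- The algebra `D_n` over `k`, presented by generators and relations. -/
abbrev Dn (k : Type*) [Field k] (n : ℕ) (q : k) : Type _ := RingQuot (Rel k n q)

/-- The image of a generator in `D_n`. -/
noncomputable def gen (k : Type*) [Field k] (n : ℕ) (q : k) (g : Gen) : Dn k n q :=
  RingQuot.mkAlgHom k (Rel k n q) (FreeAlgebra.ι k g)

/-- The relations of `D_n`, for a family of four elements of an algebra. -/
structure Satisfies {k R : Type*} [Field k] [Ring R] [Algebra k R] (n : ℕ) (q : k)
    (x : Gen → R) : Prop where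
  ba : x .b * x .a = q • (x .a * x .b)
  db : x .d * x .b = q • (x .b * x .d)
  ca : x .c * x .a = q • (x .a * x .c)
  dc : x .d * x .c = q • (x .c * x .d)
  bc : x .b * x .c = x .c * x .b
  da : x .d * x .a - q • (x .a * x .d) = 1 - x .b * x .c
  an : x .a ^ n = 0
  dn : x .d ^ n = 0
  bn : x .b ^ n = 1
  cn : x .c ^ n = 1

/-- The algebra homomorphism out of `D_n` given by elements satisfying the relations. -/
noncomputable def lift {k R : Type*} [Field k] [Ring R] [Algebra k R] {n : ℕ} {q : k}
    (x : Gen → R) (hx : Satisfies n q x) : Dn k n q →ₐ[k] R :=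
  RingQuot.liftAlgHom k ⟨FreeAlgebra.lift k x, by
    rintro _ _ (_ | _)
    · simpa using hx.ba
    · simpa using hx.db
    · simpa using hx.ca
    · simpa using hx.dc
    · simpa using hx.bc
    · simpa using hx.da
    · simpa using hx.an
    · simpa using hx.dn
    · simpa using hx.bn
    · simpa using hx.cn⟩

theorem lift_gen {k R : Type*} [Field k] [Ring R] [Algebra k R] {n : ℕ} {q : k}
    (x : Gen → R) (hx : Satisfies n q x) (g : Gen) : lift x hx (gen k n q g) = x g := by
  simp [lift, gen, RingQuot.liftAlgHom_mkAlgHom_apply]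

theorem satisfies_gen (k : Type*) [Field k] (n : ℕ) (q : k) : Satisfies n q (gen k n q) where
  ba := by simpa [gen] using RingQuot.mkAlgHom_rel k (Rel.ba (k := k) (n := n) (q := q))
  db := by simpa [gen] using RingQuot.mkAlgHom_rel k (Rel.db (k := k) (n := n) (q := q))
  ca := by simpa [gen] using RingQuot.mkAlgHom_rel k (Rel.ca (k := k) (n := n) (q := q))
  dc := by simpa [gen] using RingQuot.mkAlgHom_rel k (Rel.dc (k := k) (n := n) (q := q))
  bc := by simpa [gen] using RingQuot.mkAlgHom_rel k (Rel.bc (k := k) (n := n) (q := q))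
  da := by simpa [gen] using RingQuot.mkAlgHom_rel k (Rel.da (k := k) (n := n) (q := q))
  an := by simpa [gen] using RingQuot.mkAlgHom_rel k (Rel.an (k := k) (n := n) (q := q))
  dn := by simpa [gen] using RingQuot.mkAlgHom_rel k (Rel.dn (k := k) (n := n) (q := q))
  bn := by simpa [gen] using RingQuot.mkAlgHom_rel k (Rel.bn (k := k) (n := n) (q := q))
  cn := by simpa [gen] using RingQuot.mkAlgHom_rel k (Rel.cn (k := k) (n := n) (q := q))

/-- Gaussian binomial coefficients. -/
def gauss {k : Type*} [Field k] (q : k) : ℕ → ℕ → k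
  | _, 0 => 1
  | 0, _ + 1 => 0
  | m + 1, i + 1 => gauss q m i + q ^ (i + 1) * gauss q m (i + 1)

theorem gauss_eq_zero {k : Type*} [Field k] (q : k) (m : ℕ) :
    ∀ i, m < i → gauss q m i = 0 := by
  induction m with
  | zero => rintro (_ | i) h <;> simp_all [gauss]
  | succ m ih =>
    rintro (_ | i) h
    · omega
    · simp [gauss, ih i (by omega), ih (i + 1) (by omega)]

theorem gauss_self {k : Type*} [Field k] (q : k) (m : ℕ) : gauss q m m = 1 := by
  induction m with
  | zero => simp [gauss]
  | succ m ih => simp [gauss, ih, gauss_eq_zero]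

theorem gauss_mul {k : Type*} [Field k] (q : k) (m : ℕ) : ∀ i, i ≤ m →
    gauss q m (i + 1) * (q ^ (i + 1) - 1) = gauss q m i * (q ^ (m - i) - 1) := by
  induction m with
  | zero => intro i hi; obtain rfl : i = 0 := by omega
            simp [gauss]
  | succ m ih =>
    rintro (_ | i) hi
    · have := ih 0 (by omega)
      simp only [gauss, zero_add, pow_one, Nat.sub_zero, one_mul] at this ⊢
      linear_combination q * this
    · have h1 := ih i (by omega)
      rcases Nat.lt_or_ge i m with h | h
      · have h2 := ih (i + 1) (by omega)
        obtain ⟨t, rfl⟩ : ∃ t, m = i + 1 + t := ⟨m - (i + 1), by omega⟩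
        rw [show i + 1 + t - i = t + 1 by omega] at h1
        rw [show i + 1 + t - (i + 1) = t by omega] at h2
        rw [show i + 1 + t + 1 - (i + 1) = t + 1 by omega]
        simp only [gauss]
        linear_combination h1 + q ^ (i + 2) * h2
      · obtain rfl : i = m := by omega
        simp [gauss_eq_zero]

theorem gauss_root {k : Type*} [Field k] {q : k} {n : ℕ} (hq : IsPrimitiveRoot q n) :
    ∀ i, 0 < i → i < n → gauss q n i = 0 := by
  intro i
  induction i with
  | zero => simp
  | succ i ih =>
    intro _ hi
    have h := gauss_mul q n i (by omega)
    have hne : q ^ (i + 1) - 1 ≠ 0 :=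
      sub_ne_zero.2 (hq.pow_ne_one_of_pos_of_lt (by omega) hi)
    have hz : gauss q n i * (q ^ (n - i) - 1) = 0 := by
      rcases Nat.eq_zero_or_pos i with rfl | hp
      · simp [hq.pow_eq_one]
      · simp [ih hp (by omega)]
    rw [hz] at h
    exact (mul_eq_zero.1 h).resolve_right hne

theorem add_pow_gauss {k R : Type*} [Field k] [Ring R] [Algebra k R] (q : k) (x y : R)
    (h : x * y = q • (y * x)) (m : ℕ) :
    (y + x) ^ m = ∑ i ∈ Finset.range (m + 1), gauss q m i • (y ^ i * x ^ (m - i)) := by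
  have hxy : ∀ i, x * y ^ i = q ^ i • (y ^ i * x) := by
    intro i
    induction i with
    | zero => simp
    | succ i ih =>
      rw [pow_succ, ← mul_assoc, ih, smul_mul_assoc, mul_assoc, h, mul_smul_comm, smul_smul,
        pow_succ, mul_assoc]
  induction m with
  | zero => simp [gauss]
  | succ m ih =>
    rw [pow_succ', ih, add_mul, Finset.mul_sum, Finset.mul_sum, Finset.sum_range_succ' _ (m + 1)]
    have e : ∀ i ∈ Finset.range (m + 1), gauss q (m + 1) (i + 1) •
        (y ^ (i + 1) * x ^ (m + 1 - (i + 1))) = y * (gauss q m i • (y ^ i * x ^ (m - i))) +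
          (q ^ (i + 1) * gauss q m (i + 1)) • (y ^ (i + 1) * x ^ (m - i)) := by
      intro i _
      rw [gauss, add_smul, Nat.add_sub_add_right, mul_smul_comm, ← mul_assoc, ← pow_succ']
    rw [Finset.sum_congr rfl e, Finset.sum_add_distrib, add_assoc]
    congr 1
    have e2 : ∀ i ∈ Finset.range (m + 1), x * (gauss q m i • (y ^ i * x ^ (m - i))) =
        (q ^ i * gauss q m i) • (y ^ i * x ^ (m + 1 - i)) := by
      intro i hi
      rw [Finset.mem_range] at hi
      rw [mul_smul_comm, ← mul_assoc, hxy, smul_mul_assoc, mul_assoc, ← pow_succ', smul_smul,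
        mul_comm, show m - i + 1 = m + 1 - i by omega]
    rw [Finset.sum_congr rfl e2, Finset.sum_range_succ' _ m, Finset.sum_range_succ _ m]
    simp [gauss, gauss_eq_zero]

theorem add_pow_root {k R : Type*} [Field k] [Ring R] [Algebra k R] {q : k} {n : ℕ}
    (hq : IsPrimitiveRoot q n) (hn : 0 < n) (x y : R) (h : x * y = q • (y * x)) :
    (y + x) ^ n = y ^ n + x ^ n := by
  rw [add_pow_gauss q x y h, Finset.sum_range_succ, gauss_self]
  obtain ⟨m, rfl⟩ : ∃ m, n = m + 1 := ⟨n - 1, by omega⟩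
  rw [Finset.sum_range_succ', Finset.sum_eq_zero]
  · simp [gauss, add_comm]
  · intro i hi
    rw [Finset.mem_range] at hi
    simp [gauss_root hq (i + 1) (by omega) (by omega)]

/-- The values of the coproduct on the generators: `b` and `c` are grouplike, and
`Δ a = a ⊗ b + 1 ⊗ a`, `Δ d = d ⊗ c + 1 ⊗ d`. -/
noncomputable def comulGen (k : Type*) [Field k] (n : ℕ) (q : k) :
    Gen → Dn k n q ⊗[k] Dn k n q
  | .a => gen k n q .a ⊗ₜ gen k n q .b + 1 ⊗ₜ gen k n q .a
  | .b => gen k n q .b ⊗ₜ gen k n q .b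
  | .c => gen k n q .c ⊗ₜ gen k n q .c
  | .d => gen k n q .d ⊗ₜ gen k n q .c + 1 ⊗ₜ gen k n q .d

theorem satisfies_comulGen {k : Type*} [Field k] {n : ℕ} {q : k} (hq : IsPrimitiveRoot q n)
    (hn : 0 < n) : Satisfies n q (comulGen k n q) := by
  have h := satisfies_gen k n q
  constructor <;> simp only [comulGen]
  · simp only [mul_add, add_mul, Algebra.TensorProduct.tmul_mul_tmul, h.ba, mul_one, one_mul,
      smul_add, TensorProduct.smul_tmul', TensorProduct.tmul_smul]
  · simp only [mul_add, add_mul, Algebra.TensorProduct.tmul_mul_tmul, h.db, mul_one, one_mul,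
      smul_add, TensorProduct.smul_tmul', TensorProduct.tmul_smul, h.bc]
  · simp only [mul_add, add_mul, Algebra.TensorProduct.tmul_mul_tmul, h.ca, mul_one, one_mul,
      smul_add, TensorProduct.smul_tmul', TensorProduct.tmul_smul, h.bc]
  · simp only [mul_add, add_mul, Algebra.TensorProduct.tmul_mul_tmul, h.dc, mul_one, one_mul,
      smul_add, TensorProduct.smul_tmul', TensorProduct.tmul_smul]
  · simp only [Algebra.TensorProduct.tmul_mul_tmul, h.bc]
  · have e1 : gen k n q .d * gen k n q .a =
        q • (gen k n q .a * gen k n q .d) + (1 - gen k n q .b * gen k n q .c) := by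
      rw [← h.da]; abel
    simp only [mul_add, add_mul, Algebra.TensorProduct.tmul_mul_tmul, h.ca, h.db, ← h.bc, e1,
      mul_one, one_mul, smul_add, TensorProduct.add_tmul, TensorProduct.tmul_add,
      TensorProduct.sub_tmul, TensorProduct.tmul_sub, TensorProduct.smul_tmul',
      TensorProduct.tmul_smul, Algebra.TensorProduct.one_def]
    abel
  · rw [add_comm]
    refine (add_pow_root (R := Dn k n q ⊗[k] Dn k n q) hq hn _ _ ?_).trans ?_
    · simp [Algebra.TensorProduct.tmul_mul_tmul, h.ba]
    · simp [Algebra.TensorProduct.tmul_pow, h.an]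
  · refine (add_pow_root (R := Dn k n q ⊗[k] Dn k n q) hq hn _ _ ?_).trans ?_
    · simp [Algebra.TensorProduct.tmul_mul_tmul, h.dc]
    · simp [Algebra.TensorProduct.tmul_pow, h.dn]
  · simp [Algebra.TensorProduct.tmul_pow, h.bn, Algebra.TensorProduct.one_def]
  · simp [Algebra.TensorProduct.tmul_pow, h.cn, Algebra.TensorProduct.one_def]

/-- The coproduct of `D_n`. -/
noncomputable def comul {k : Type*} [Field k] {n : ℕ} {q : k} (hq : IsPrimitiveRoot q n)
    (hn : 0 < n) : Dn k n q →ₐ[k] Dn k n q ⊗[k] Dn k n q :=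
  lift (comulGen k n q) (satisfies_comulGen hq hn)

/-- The tensor product of two representations of `D_n`: the action on `V ⊗ W` is
`x • (v ⊗ w) = ∑ x₁ v ⊗ x₂ w`, where `Δ x = ∑ x₁ ⊗ x₂`. -/
noncomputable def tensorRep {k : Type*} [Field k] {n : ℕ} {q : k} (hq : IsPrimitiveRoot q n)
    (hn : 0 < n) {V W : Type*} [AddCommGroup V] [Module k V] [AddCommGroup W] [Module k W]
    (ρ : Dn k n q →ₐ[k] Module.End k V) (σ : Dn k n q →ₐ[k] Module.End k W) :
    Dn k n q →ₐ[k] Module.End k (V ⊗[k] W) :=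
  (Module.endTensorEndAlgHom (R := k) (S := k) (A := k) (M := V) (N := W)).comp
    ((Algebra.TensorProduct.map ρ σ).comp (comul hq hn))

/-! ### The simple modules -/

/-- The scalar `α_i(ℓ) = (q^i - 1)(1 - q^(i-ℓ)) / (q - 1)`. -/
noncomputable def alpha {k : Type*} [Field k] (q : k) (ℓ i : ℕ) : k :=
  (q ^ i - 1) * (1 - q ^ ((i : ℤ) - ℓ)) / (q - 1)

/-- The operators by which the generators act on `V(ℓ, r)`. The standard basis vector of
`Fin ℓ → k` with index `j` is the vector `v_{j+1}`, so that
`a v_j = v_{j+1}`, `a v_ℓ = 0`, `b v_j = q^(r+j-1) v_j`, `c v_j = q^(j-(r+ℓ)) v_j`,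
`d v_j = α_{j-1}(ℓ) v_{j-1}`, `d v_1 = 0`. -/
noncomputable def simpleGen {k : Type*} [Field k] {n : ℕ} (q : k) (ℓ : ℕ) (r : ZMod n) :
    Gen → Module.End k (Fin ℓ → k)
  | .a => (Pi.basisFun k (Fin ℓ)).constr k fun j =>
      if h : (j : ℕ) + 1 < ℓ then Pi.single ⟨j + 1, h⟩ 1 else 0
  | .b => (Pi.basisFun k (Fin ℓ)).constr k fun j =>
      q ^ ((r.val : ℤ) + ((j : ℕ) + 1) - 1) • Pi.single j 1
  | .c => (Pi.basisFun k (Fin ℓ)).constr k fun j =>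
      q ^ (((j : ℕ) + 1 : ℤ) - (r.val + ℓ)) • Pi.single j 1
  | .d => (Pi.basisFun k (Fin ℓ)).constr k fun j =>
      if 0 < (j : ℕ) then
        alpha q ℓ j • Pi.single ⟨j - 1, (Nat.sub_le _ _).trans_lt j.isLt⟩ 1
      else 0

section simpleGen

variable {k : Type*} [Field k] {n : ℕ} (q : k) (ℓ : ℕ) (r : ZMod n)

theorem simpleGen_a (j : Fin ℓ) : simpleGen q ℓ r .a (Pi.single j 1) =
    if h : (j : ℕ) + 1 < ℓ then Pi.single ⟨j + 1, h⟩ 1 else 0 := by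
  rw [← Pi.basisFun_apply]; exact Module.Basis.constr_basis ..

theorem simpleGen_b (j : Fin ℓ) : simpleGen q ℓ r .b (Pi.single j 1) =
    q ^ ((r.val : ℤ) + ((j : ℕ) + 1) - 1) • Pi.single j 1 := by
  have h := Module.Basis.constr_basis (Pi.basisFun k (Fin ℓ)) k
    (fun j : Fin ℓ => q ^ ((r.val : ℤ) + ((j : ℕ) + 1) - 1) • (Pi.single j 1 : Fin ℓ → k)) j
  rwa [Pi.basisFun_apply] at h

theorem simpleGen_c (j : Fin ℓ) : simpleGen q ℓ r .c (Pi.single j 1) =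
    q ^ (((j : ℕ) + 1 : ℤ) - (r.val + ℓ)) • Pi.single j 1 := by
  have h := Module.Basis.constr_basis (Pi.basisFun k (Fin ℓ)) k
    (fun j : Fin ℓ => q ^ (((j : ℕ) + 1 : ℤ) - (r.val + ℓ)) • (Pi.single j 1 : Fin ℓ → k)) j
  rwa [Pi.basisFun_apply] at h

theorem simpleGen_d (j : Fin ℓ) : simpleGen q ℓ r .d (Pi.single j 1) =
    if 0 < (j : ℕ) then
      alpha q ℓ j • Pi.single ⟨j - 1, (Nat.sub_le _ _).trans_lt j.isLt⟩ 1
    else 0 := by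
  rw [← Pi.basisFun_apply]; exact Module.Basis.constr_basis ..

theorem simpleGen_a_pow (m : ℕ) : ∀ j : Fin ℓ, ℓ ≤ j + m →
    (simpleGen q ℓ r .a ^ m) (Pi.single j 1) = 0 := by
  induction m with
  | zero => intro j hj; omega
  | succ m ih =>
    intro j hj
    rw [pow_succ, Module.End.mul_apply, simpleGen_a]
    split_ifs with h
    · exact ih _ (by simp; omega)
    · simp

theorem simpleGen_d_pow (m : ℕ) : ∀ j : Fin ℓ, (j : ℕ) < m →
    (simpleGen q ℓ r .d ^ m) (Pi.single j 1) = 0 := by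
  induction m with
  | zero => intro j hj; omega
  | succ m ih =>
    intro j hj
    rw [pow_succ, Module.End.mul_apply, simpleGen_d]
    split_ifs with h
    · rw [map_smul, ih _ (by simp; omega), smul_zero]
    · simp

theorem simpleGen_b_pow (m : ℕ) (j : Fin ℓ) : (simpleGen q ℓ r .b ^ m) (Pi.single j 1) =
    (q ^ ((r.val : ℤ) + ((j : ℕ) + 1) - 1)) ^ m • Pi.single j 1 := by
  induction m with
  | zero => simp
  | succ m ih =>
    rw [pow_succ, Module.End.mul_apply, simpleGen_b, LinearMap.map_smul, ih, smul_smul, pow_succ']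

theorem simpleGen_c_pow (m : ℕ) (j : Fin ℓ) : (simpleGen q ℓ r .c ^ m) (Pi.single j 1) =
    (q ^ (((j : ℕ) + 1 : ℤ) - (r.val + ℓ))) ^ m • Pi.single j 1 := by
  induction m with
  | zero => simp
  | succ m ih =>
    rw [pow_succ, Module.End.mul_apply, simpleGen_c, LinearMap.map_smul, ih, smul_smul, pow_succ']

end simpleGen

theorem satisfies_simpleGen {k : Type*} [Field k] {n : ℕ} {q : k} (hq : IsPrimitiveRoot q n)
    (hn : 1 < n) {ℓ : ℕ} (hℓ : ℓ ≤ n) (r : ZMod n) : Satisfies n q (simpleGen q ℓ r) := by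
  have hq0 : q ≠ 0 := hq.ne_zero (by omega)
  have hq1 : q - 1 ≠ 0 := sub_ne_zero.2 (hq.ne_one hn)
  have hpow : ∀ m : ℤ, (q ^ m) ^ n = 1 := fun m => by
    rw [← zpow_natCast, ← zpow_mul, mul_comm, zpow_mul, zpow_natCast, hq.pow_eq_one, one_zpow]
  constructor <;> refine (Pi.basisFun k (Fin ℓ)).ext fun j => ?_ <;>
    simp only [Pi.basisFun_apply, Module.End.mul_apply, LinearMap.smul_apply,
      LinearMap.sub_apply, Module.End.one_apply, LinearMap.zero_apply]
  · rw [simpleGen_a, simpleGen_b, map_smul, simpleGen_a]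
    split_ifs with h
    · rw [simpleGen_b, smul_smul, ← zpow_one_add₀ hq0]
      congr 2; push_cast; ring
    · simp
  · rw [simpleGen_d, simpleGen_b, map_smul, simpleGen_d]
    split_ifs with h
    · rw [map_smul, simpleGen_b, smul_smul, smul_smul, smul_smul, mul_right_comm,
        ← zpow_one_add₀ hq0]
      congr 3; push_cast [Nat.cast_sub (show 1 ≤ (j : ℕ) from h)]; ring
    · simp
  · rw [simpleGen_a, simpleGen_c, map_smul, simpleGen_a]
    split_ifs with h
    · rw [simpleGen_c, smul_smul, ← zpow_one_add₀ hq0]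
      congr 2; push_cast; ring
    · simp
  · rw [simpleGen_d, simpleGen_c, map_smul, simpleGen_d]
    split_ifs with h
    · rw [map_smul, simpleGen_c, smul_smul, smul_smul, smul_smul, mul_right_comm,
        ← zpow_one_add₀ hq0]
      congr 3; push_cast [Nat.cast_sub (show 1 ≤ (j : ℕ) from h)]; ring
    · simp
  · rw [simpleGen_b, simpleGen_c, map_smul, map_smul, simpleGen_b, simpleGen_c, smul_comm]
  · have e1 : simpleGen q ℓ r .d (simpleGen q ℓ r .a (Pi.single j 1)) =
        alpha q ℓ (j + 1) • Pi.single j 1 := by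
      rw [simpleGen_a]
      split_ifs with h
      · rw [simpleGen_d]; simp
      · have : (j : ℕ) + 1 = ℓ := by omega
        simp [this, alpha]
    have e2 : simpleGen q ℓ r .a (simpleGen q ℓ r .d (Pi.single j 1)) =
        alpha q ℓ j • Pi.single j 1 := by
      rw [simpleGen_d]
      split_ifs with h
      · rw [map_smul, simpleGen_a]
        have : (j : ℕ) - 1 + 1 = j := by omega
        simp [this]
      · have : (j : ℕ) = 0 := by omega
        simp [this, alpha]
    have e3 : simpleGen q ℓ r .b (simpleGen q ℓ r .c (Pi.single j 1)) =
        q ^ (2 * (j : ℤ) + 1 - ℓ) • Pi.single j 1 := by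
      rw [simpleGen_c, map_smul, simpleGen_b, smul_smul, ← zpow_add₀ hq0]
      congr 2; ring
    have e4 : ∀ (x : k) (v : Fin ℓ → k), v - x • v = (1 - x) • v := fun x v => by
      rw [sub_smul, one_smul]
    rw [e1, e2, e3, smul_smul, ← sub_smul, e4]
    congr 1
    simp only [alpha]
    rw [show (((j : ℕ) + 1 : ℕ) : ℤ) - ℓ = (j : ℤ) + 1 + -ℓ by push_cast; ring,
      show ((j : ℕ) : ℤ) - ℓ = (j : ℤ) + -ℓ by ring,
      show 2 * ((j : ℕ) : ℤ) + 1 - ℓ = (j : ℤ) + j + 1 + -ℓ by ring]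
    simp only [zpow_add₀ hq0, zpow_natCast, zpow_one]
    field_simp
    ring
  · exact simpleGen_a_pow q ℓ r n j (by omega)
  · exact simpleGen_d_pow q ℓ r n j (by omega)
  · rw [simpleGen_b_pow, hpow, one_smul]
  · rw [simpleGen_c_pow, hpow, one_smul]

/-- The representation of `D_n` on the simple module `V(ℓ, r)`, `ℓ ≤ n`, `r ∈ ℤ/n`. -/
noncomputable def simpleRep {k : Type*} [Field k] {n : ℕ} {q : k} (hq : IsPrimitiveRoot q n)
    (hn : 1 < n) (ℓ : ℕ) (hℓ : ℓ ≤ n) (r : ZMod n) :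
    Dn k n q →ₐ[k] Module.End k (Fin ℓ → k) :=
  lift (simpleGen q ℓ r) (satisfies_simpleGen hq hn hℓ r)

/-! ### McKay matrices -/

/-- The McKay matrix `M_V` for tensoring with the `D_n`-module `V` given by `σ`. Its rows and
columns are indexed by the simple modules, the index `(i, r)` standing for `V(i+1, r)`, and its
entries are the composition multiplicities `[V(ℓ, r) ⊗ V : V(ℓ', s)]`. -/
noncomputable def mckayMatrix {k : Type*} [Field k] {n : ℕ} {q : k} (hq : IsPrimitiveRoot q n)
    (hn : 1 < n) {V : Type*} [AddCommGroup V] [Module k V]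
    (σ : Dn k n q →ₐ[k] Module.End k V) : Matrix (Fin n × ZMod n) (Fin n × ZMod n) ℕ :=
  Matrix.of fun x y =>
    compMult (Dn k n q)
      (RepModule (tensorRep hq (Nat.zero_lt_of_lt hn)
        (simpleRep hq hn (x.1 + 1) x.1.isLt x.2) σ))
      (RepModule (simpleRep hq hn (y.1 + 1) y.1.isLt y.2))

/-- The McKay matrix for tensoring with `V(2, 0)`, with entries viewed in `k`. -/
noncomputable def mckayMatrixTwo {k : Type*} [Field k] {n : ℕ} {q : k}
    (hq : IsPrimitiveRoot q n) (hn : 1 < n) : Matrix (Fin n × ZMod n) (Fin n × ZMod n) k :=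
  (mckayMatrix hq hn (simpleRep hq hn 2 hn 0)).map Nat.cast

/-- The `n × n` cyclic permutation matrix `Z`, with entries `1` in the positions `(s, s + 1)`,
`s ∈ ℤ/n`. -/
def cyclicMatrix (k : Type*) [Field k] (n : ℕ) : Matrix (ZMod n) (ZMod n) k :=
  Matrix.of fun s t => if t = s + 1 then 1 else 0

/-- The `n² × n²` matrix in `n × n` blocks with identity blocks on the superdiagonal, `Z` on the
subdiagonal except in the last row, and last row `[2I 0 ⋯ 0 2Z 0]`. -/
def blockMatrix (k : Type*) [Field k] (n : ℕ) :
    Matrix (Fin n × ZMod n) (Fin n × ZMod n) k :=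
  Matrix.of fun x y =>
    (if (x.1 : ℕ) + 1 < n then
      if (y.1 : ℕ) = x.1 + 1 then (1 : Matrix (ZMod n) (ZMod n) k)
      else if (y.1 : ℕ) + 1 = x.1 then cyclicMatrix k n
      else 0
    else
      if (y.1 : ℕ) = 0 then (2 : k) • (1 : Matrix (ZMod n) (ZMod n) k)
      else if (y.1 : ℕ) + 1 = x.1 then (2 : k) • cyclicMatrix k n
      else 0) x.2 y.2

/-! ### Left eigenvectors -/

/-- `v` is a left eigenvector of `M` with eigenvalue `μ`. -/
def IsLeftEigenvector {k ι : Type*} [Field k] [Fintype ι] (M : Matrix ι ι k) (μ : k)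
    (v : ι → k) : Prop :=
  v ≠ 0 ∧ v ᵥ* M = μ • v

/-- `v` is a generalized left eigenvector of `M` with eigenvalue `μ`: the vector
`v (M - μ I)` is a (nonzero) left eigenvector of `M` with eigenvalue `μ`. -/
def IsGeneralizedLeftEigenvector {k ι : Type*} [Field k] [Fintype ι] [DecidableEq ι]
    (M : Matrix ι ι k) (μ : k) (v : ι → k) : Prop :=
  IsLeftEigenvector M μ (v ᵥ* (M - μ • (1 : Matrix ι ι k)))

/-- The row vector `[u_{n-1} u_{n-2} ⋯ u_1 u_0]` with blocks `u_m ∈ k^n`. -/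
def revBlocks {k : Type*} {n : ℕ} (u : ℕ → ZMod n → k) : Fin n × ZMod n → k :=
  fun x => u (n - 1 - x.1) x.2

/-- The scalar `λ_{j,r} = q^r (q^j + q^(-j))`. -/
noncomputable def eigenval {k : Type*} [Field k] {n : ℕ} (q : k) (j : ℕ) (r : ZMod n) : k :=
  q ^ r.val * (q ^ j + (q ^ j)⁻¹)

/-- The modified Chebyshev polynomials of the first kind
`L_0 = 2`, `L_1 = t`, `L_m = t L_{m-1} - L_{m-2}`, evaluated at `t`. -/
noncomputable def chebL {k : Type*} [Field k] (m : ℕ) (t : k) : k :=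
  (Polynomial.Chebyshev.C k m).eval t

/-- The rescaled Chebyshev polynomials of the second kind
`U_0 = 1`, `U_1 = t`, `U_m = t U_{m-1} - U_{m-2}`, evaluated at `t`. -/
noncomputable def chebU {k : Type*} [Field k] (m : ℕ) (t : k) : k :=
  (Polynomial.Chebyshev.S k m).eval t

/-- The blocks `w_0 = w` and `w_m = q^(mr) L_m(q^j + q^(-j)) w` for `m ≥ 1`. -/
noncomputable def wBlock {k : Type*} [Field k] {n : ℕ} (q : k) (j : ℕ) (r : ZMod n)
    (w : ZMod n → k) : ℕ → ZMod n → k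
  | 0 => w
  | m + 1 => (q ^ ((m + 1) * r.val) * chebL (m + 1) (q ^ j + (q ^ j)⁻¹)) • w

/-- The blocks `y_0 = w`, `y_1 = q^r U_1 w + w`, and
`y_m = q^(mr) (U_m - U_{m-2}) w + m q^((m-1)r) U_{m-1} w` for `m ≥ 2`, where
`U_i = U_i(q^j + q^(-j))`. -/
noncomputable def yBlock {k : Type*} [Field k] {n : ℕ} (q : k) (j : ℕ) (r : ZMod n)
    (w : ZMod n → k) : ℕ → ZMod n → k
  | 0 => w
  | 1 => (q ^ r.val * chebU 1 (q ^ j + (q ^ j)⁻¹)) • w + w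
  | m + 2 =>
      (q ^ ((m + 2) * r.val) *
        (chebU (m + 2) (q ^ j + (q ^ j)⁻¹) - chebU m (q ^ j + (q ^ j)⁻¹))) • w +
      (((m + 2 : ℕ) : k) * q ^ ((m + 1) * r.val) * chebU (m + 1) (q ^ j + (q ^ j)⁻¹)) • w

end TaftDouble

open TaftDouble

/-! The statement has two independent halves: the block form of the McKay matrix, and linear algebra
on that matrix.

Block form. In `V(ℓ, r) ⊗ V(2, 0)` write `t i j` for `v_{i+1} ⊗ v_{j+1}`. A vector killed by `d` and
`a ^ ℓ` modulo a submodule `N`, with the `b`, `c` weights of `v_1`, gives a map from the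
corresponding simple module to the quotient by `N`. Adjoining the images of such maps one at a time
builds a filtration. For `ℓ < n` the vectors `t 0 0`, `t 0 1` give `V(ℓ+1, r)` and `V(ℓ-1, r+1)`,
the second absent when `ℓ = 1`. For `ℓ = n` the quantum integer `[n]` vanishes and `a • t 0 0`, `t 0
0`, `t (n-1) 1`, `t 0 1` give `V(n-1, r+1)`, `V(1, r)`, `V(1, r)`, `V(n-1, r+1)`. None of these maps
is checked to be injective. Each step raises the dimension by at most that of the simple module, the
filtration reaches the whole space, and the dimensions add up to exactly `2ℓ`, so no step can have
lost anything. This is what `FactorBound` records.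

Eigenvectors. On row vectors with blocks `c m • w`, where `w Z = R² w` and `R = q^r`, the matrix
acts by a three-term recurrence in `m`. With eigenvalue `ν = R t` its solution is `c m = R^m L_m(t)`
for `m ≥ 1`; the doubled last row accounts for `c 0 = 1` against `L_0 = 2`. One equation remains,
the closing condition `R^n L_n(t) = 2`, which holds at `t = Q + Q⁻¹`, `Q = q^j`, because `R^n = Q^n
= 1`. Since `L_n' = n U_{n-1}` and `U_{n-1}(t) = 0` when `Q ≠ Q⁻¹`, the root is then double. So
differentiating the eigenvector equation in `ν` gives `w' M = ν w' + w` with `w'` having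
coefficients `m R^(m-1) U_{m-1}`, and the vector `y` is `w + w'`. -/

namespace TaftDouble

/-! ### Composition multiplicities from filtrations controlled by dimension -/

section Filtration

variable {k A M : Type*} [Field k] [Ring A] [Algebra k A] [AddCommGroup M] [Module A M]

/-- The factor `Y / X` of a pair of submodules is isomorphic to `S`. -/
def FactorIso (S : Type*) [AddCommGroup S] [Module A S] (X Y : Submodule A M) : Prop :=
  Nonempty ((Y ⧸ X.comap Y.subtype) ≃ₗ[A] S)

open Classical in
theorem factorCount_eq_sum (S : Type*) [AddCommGroup S] [Module A S]
    (s : CompositionSeries (Submodule A M)) :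
    factorCount S s = ∑ i : Fin s.length,
      if FactorIso S (s i.castSucc) (s i.succ) then 1 else 0 := by
  rw [Finset.sum_boole, Nat.cast_id, ← Fintype.card_subtype, ← Nat.card_eq_fintype_card]
  rfl

open Classical in
theorem factorCount_snoc (S : Type*) [AddCommGroup S] [Module A S]
    (s : CompositionSeries (Submodule A M)) (Y : Submodule A M)
    (h : JordanHolderLattice.IsMaximal s.last Y) :
    factorCount S (s.snoc Y h) =
      factorCount S s + if FactorIso S s.last Y then 1 else 0 := by
  rw [factorCount_eq_sum, factorCount_eq_sum]
  refine (Fin.sum_univ_castSucc (n := s.length) _).trans ?_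
  congr 1
  · refine Finset.sum_congr rfl fun i _ => ?_
    rw [RelSeries.snoc_castSucc, ← RelSeries.snoc_castSucc s Y h i.succ]
    rfl
  · have e1 : (s.snoc Y h).toFun (Fin.last s.length).castSucc = s.last :=
      RelSeries.snoc_castSucc s Y h _
    have e2 : (s.snoc Y h).toFun (Fin.last (s.snoc Y h).length) = Y := RelSeries.last_snoc s Y h
    exact if_congr (iff_of_eq (congrArg₂ (FactorIso S) e1 e2)) rfl rfl

/-- The subquotient attached to the range of a map into `M / N`. -/
noncomputable def comapRangeEquiv {T : Type*} [AddCommGroup T] [Module A T] (N : Submodule A M)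
    (f : T →ₗ[A] M ⧸ N) (hf : Function.Injective f) :
    ((LinearMap.range f).comap N.mkQ ⧸
      N.comap ((LinearMap.range f).comap N.mkQ).subtype) ≃ₗ[A] T := by
  let g : (LinearMap.range f).comap N.mkQ →ₗ[A] LinearMap.range f :=
    N.mkQ.restrict fun x hx => hx
  have hg : Function.Surjective g := by
    rintro ⟨y, hy⟩
    obtain ⟨x, rfl⟩ := N.mkQ_surjective y
    exact ⟨⟨x, hy⟩, rfl⟩
  have hk : LinearMap.ker g = N.comap ((LinearMap.range f).comap N.mkQ).subtype := by
    ext x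
    simp [g, LinearMap.mem_ker, Subtype.ext_iff, LinearMap.restrict_apply]
  exact (Submodule.quotEquivOfEq _ _ hk.symm).trans
    ((g.quotKerEquivOfSurjective hg).trans (LinearEquiv.ofInjective f hf).symm)

variable [Module k M] [IsScalarTower k A M]

variable (k) in
/-- `N` has dimension at most `D`, and if it has dimension `D` then it has a composition series
with `c` factors isomorphic to `S`. -/
def FactorBound (S : Type*) [AddCommGroup S] [Module A S] (N : Submodule A M) (c D : ℕ) : Prop :=
  Module.finrank k N ≤ D ∧ (Module.finrank k N = D →
    ∃ s : CompositionSeries (Submodule A M), s.head = ⊥ ∧ s.last = N ∧ factorCount S s = c)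

theorem factorBound_bot (S : Type*) [AddCommGroup S] [Module A S] :
    FactorBound k S (⊥ : Submodule A M) 0 0 := by
  refine ⟨(finrank_bot k M).le, fun _ => ⟨RelSeries.singleton _ ⊥, rfl, rfl, ?_⟩⟩
  rw [factorCount_eq_sum]
  exact Fin.sum_univ_zero _

-- Rank-nullity for `Y → M / N` and for `f` gives `dim Y = dim N + dim T - dim ker f`. Attaining the
-- bound therefore forces both `dim N = D` and `f` injective, and then `Y / N` is a copy of the
-- simple module `T`, so the series for `N` extends by one term.
open Classical in
theorem FactorBound.step {S T : Type*} [AddCommGroup S] [Module A S] [AddCommGroup T] [Module A T]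
    [Module k T] [IsScalarTower k A T] [FiniteDimensional k T] [IsSimpleModule A T]
    [FiniteDimensional k M]
    {N : Submodule A M} {c D : ℕ} (h : FactorBound k S N c D) (f : T →ₗ[A] M ⧸ N) :
    FactorBound k S ((LinearMap.range f).comap N.mkQ)
      (c + if Nonempty (T ≃ₗ[A] S) then 1 else 0) (D + Module.finrank k T) := by
  set Y := (LinearMap.range f).comap N.mkQ
  have hNY : N ≤ Y := fun x hx => by
    simp [Y, (Submodule.Quotient.mk_eq_zero N).2 hx]
  let fk : T →ₗ[k] M ⧸ N := f.restrictScalars k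
  let gk : Y →ₗ[k] M ⧸ N := (N.mkQ.comp Y.subtype).restrictScalars k
  have hr : LinearMap.range gk = LinearMap.range fk := by
    ext y
    constructor
    · rintro ⟨⟨x, hx⟩, rfl⟩
      exact hx
    · rintro ⟨t, rfl⟩
      obtain ⟨x, hx⟩ := N.mkQ_surjective (f t)
      exact ⟨⟨x, t, hx.symm⟩, hx⟩
  have hker : Module.finrank k (LinearMap.ker gk) = Module.finrank k N := by
    refine LinearEquiv.finrank_eq (LinearEquiv.ofBijective
      (LinearMap.codRestrict (N.restrictScalars k)
        ((Y.subtype.restrictScalars k).comp (LinearMap.ker gk).subtype) fun x => ?_) ⟨?_, ?_⟩)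
    · exact (Submodule.Quotient.mk_eq_zero N).1 (LinearMap.mem_ker.1 x.2)
    · intro x y hxy
      exact Subtype.ext (Subtype.ext (congrArg (fun z : N.restrictScalars k => (z : M)) hxy))
    · rintro ⟨x, hx⟩
      exact ⟨⟨⟨x, hNY hx⟩, by simpa [gk] using hx⟩, rfl⟩
  have : FiniteDimensional k Y := inferInstanceAs (FiniteDimensional k (Y.restrictScalars k))
  have h1 := LinearMap.finrank_range_add_finrank_ker gk
  have h2 := LinearMap.finrank_range_add_finrank_ker fk
  rw [hr, hker] at h1
  refine ⟨by have := h.1; omega, fun hd => ?_⟩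
  have hk0 : Module.finrank k (LinearMap.ker fk) = 0 := by have := h.1; omega
  have hinj : Function.Injective f := by
    have := LinearMap.ker_eq_bot.1 (Submodule.finrank_eq_zero.1 hk0)
    exact this
  obtain ⟨s, hs0, hs1, hs2⟩ := h.2 (by have := h.1; omega)
  have hsimple : IsSimpleModule A (Y ⧸ N.comap Y.subtype) :=
    IsSimpleModule.congr (comapRangeEquiv N f hinj)
  have hcov : N ⋖ Y := (covBy_iff_quot_is_simple hNY).2 hsimple
  have hmax : JordanHolderLattice.IsMaximal s.last Y := by rw [hs1]; exact hcov
  refine ⟨s.snoc Y hmax, ?_, ?_, ?_⟩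
  · rw [RelSeries.head_snoc, hs0]
  · rw [RelSeries.last_snoc]
  · rw [factorCount_snoc, hs2, hs1]
    congr 1
    refine if_congr ⟨fun ⟨e⟩ => ⟨(comapRangeEquiv N f hinj).symm.trans e⟩,
      fun ⟨e⟩ => ⟨(comapRangeEquiv N f hinj).trans e⟩⟩ rfl rfl

/-- This is where the deferred injectivity is settled: once the filtration reaches `M` and the
dimensions agree, the conditional half of the bound applies. -/
theorem FactorBound.compMult_eq {S : Type*} [AddCommGroup S] [Module A S] {c D : ℕ}
    {N : Submodule A M} (h : FactorBound k S N c D) (hN : N = ⊤)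
    (hD : Module.finrank k M = D) : compMult A M S = c := by
  subst hN
  obtain ⟨s, h0, h1, h2⟩ := h.2 (by rw [← hD]; exact finrank_top k M)
  rw [TaftDouble.compMult_eq S s h0 h1, h2]

end Filtration

/-! ### Linear structure on the module of a representation -/

section RepModule

variable {k A V : Type*} [Field k] [Ring A] [Algebra k A] [AddCommGroup V] [Module k V]
  (ρ : A →ₐ[k] Module.End k V)

instance : Module k (RepModule ρ) := inferInstanceAs (Module k V)

instance [FiniteDimensional k V] : FiniteDimensional k (RepModule ρ) :=
  inferInstanceAs (FiniteDimensional k V)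

/-- A vector of `V`, as an element of the module attached to a representation on `V`. -/
def RepModule.of : V ≃ₗ[k] RepModule ρ := LinearEquiv.refl k V

theorem RepModule.smul_of (x : A) (v : V) :
    x • RepModule.of ρ v = RepModule.of ρ (ρ x v) := rfl

instance : IsScalarTower k A (RepModule ρ) where
  smul_assoc c x v := by
    obtain ⟨v, rfl⟩ := (RepModule.of ρ).surjective v
    rw [RepModule.smul_of, RepModule.smul_of, map_smul, LinearMap.smul_apply, map_smul]

end RepModule

/-! ### Modules over the Drinfeld double and maps between them -/

section Dn

variable {k : Type*} [Field k] {n : ℕ} {q : k}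

theorem gen_induction {p : Dn k n q → Prop} (hs : ∀ c : k, p (algebraMap k _ c))
    (hg : ∀ g, p (gen k n q g)) (hm : ∀ x y, p x → p y → p (x * y))
    (ha : ∀ x y, p x → p y → p (x + y)) (x : Dn k n q) : p x := by
  obtain ⟨y, rfl⟩ := RingQuot.mkAlgHom_surjective k (Rel k n q) x
  induction y using FreeAlgebra.induction with
  | grade0 c => rw [AlgHom.commutes]; exact hs c
  | grade1 g => exact hg g
  | mul x y hx hy => rw [map_mul]; exact hm _ _ hx hy
  | add x y hx hy => rw [map_add]; exact ha _ _ hx hy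

variable {P Q : Type*} [AddCommGroup P] [Module (Dn k n q) P] [Module k P]
  [IsScalarTower k (Dn k n q) P] [AddCommGroup Q] [Module (Dn k n q) Q] [Module k Q]
  [IsScalarTower k (Dn k n q) Q]

/-- A `k`-linear map commuting with the generators is `D_n`-linear. -/
def linearMapOfGen (f : P →ₗ[k] Q)
    (hf : ∀ g v, f (gen k n q g • v) = gen k n q g • f v) : P →ₗ[Dn k n q] Q where
  toFun := f
  map_add' := map_add f
  map_smul' x v := by
    induction x using gen_induction generalizing v with
    | hs c => rw [algebraMap_smul, map_smul, RingHom.id_apply, algebraMap_smul]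
    | hg g => exact hf g v
    | hm x y hx hy => rw [mul_smul, hx, hy, RingHom.id_apply, RingHom.id_apply, RingHom.id_apply,
        mul_smul]
    | ha x y hx hy => rw [add_smul, map_add, hx, hy, RingHom.id_apply, RingHom.id_apply,
        RingHom.id_apply, add_smul]

section Relations

variable (n q) in
/-- The operator of a generator on a `D_n`-module is `k`-linear. -/
theorem gen_smul_smul (g : Gen) (c : k) (v : P) :
    gen k n q g • c • v = c • gen k n q g • v := by
  rw [← algebraMap_smul (Dn k n q) c v, ← mul_smul, ← Algebra.commutes, mul_smul, algebraMap_smul]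

theorem ba_smul (v : P) :
    gen k n q .b • gen k n q .a • v = q • gen k n q .a • gen k n q .b • v := by
  rw [← mul_smul, (satisfies_gen k n q).ba, smul_assoc, mul_smul]

theorem ca_smul (v : P) :
    gen k n q .c • gen k n q .a • v = q • gen k n q .a • gen k n q .c • v := by
  rw [← mul_smul, (satisfies_gen k n q).ca, smul_assoc, mul_smul]

theorem da_smul (v : P) : gen k n q .d • gen k n q .a • v =
    q • gen k n q .a • gen k n q .d • v + (v - gen k n q .b • gen k n q .c • v) := by
  have h := (satisfies_gen k n q).da
  rw [sub_eq_iff_eq_add] at h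
  rw [← mul_smul, h, add_smul, sub_smul, one_smul, mul_smul, smul_assoc, mul_smul, add_comm]

end Relations

/-- `u` is killed by `d` and `a ^ ℓ`, and `b`, `c` act on it as on the vector `v_1` of
`V(ℓ, r)`. -/
structure IsHighestWeight (ℓ : ℕ) (r : ZMod n) (u : P) : Prop where
  a : gen k n q .a ^ ℓ • u = 0
  b : gen k n q .b • u = q ^ (r.val : ℤ) • u
  c : gen k n q .c • u = q ^ (1 - (r.val + ℓ : ℤ)) • u
  d : gen k n q .d • u = 0

/-! ### The action on the vectors `a ^ i • u` for a highest weight vector `u` -/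

namespace IsHighestWeight

variable {ℓ : ℕ} {r : ZMod n} {u : P}

theorem b_pow (hq0 : q ≠ 0) (h : IsHighestWeight (q := q) ℓ r u) (i : ℕ) :
    gen k n q .b • gen k n q .a ^ i • u = q ^ ((r.val : ℤ) + i) • gen k n q .a ^ i • u := by
  induction i with
  | zero => simpa using h.b
  | succ i ih =>
    rw [pow_succ', mul_smul, ba_smul, ih, gen_smul_smul, smul_smul, ← zpow_one_add₀ hq0]
    congr 2; push_cast; ring

theorem c_pow (hq0 : q ≠ 0) (h : IsHighestWeight (q := q) ℓ r u) (i : ℕ) :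
    gen k n q .c • gen k n q .a ^ i • u =
      q ^ ((i : ℤ) + 1 - (r.val + ℓ)) • gen k n q .a ^ i • u := by
  induction i with
  | zero => simpa using h.c
  | succ i ih =>
    rw [pow_succ', mul_smul, ca_smul, ih, gen_smul_smul, smul_smul, ← zpow_one_add₀ hq0]
    congr 2; push_cast; ring

/-- Commuting `d` past one `a` by `da = q ad + 1 - bc` turns the claim into `α_{i+1} = q α_i + 1 -
q^(2i+1-ℓ)`, the last power being the weight of `bc`. The truncated `i - 1` is harmless at `i = 0`
because `α_0 = 0`. -/
theorem d_pow (hq0 : q ≠ 0) (hq1 : q - 1 ≠ 0) (h : IsHighestWeight (q := q) ℓ r u) (i : ℕ) :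
    gen k n q .d • gen k n q .a ^ i • u = alpha q ℓ i • gen k n q .a ^ (i - 1) • u := by
  induction i with
  | zero => simpa [alpha] using h.d
  | succ i ih =>
    have e : gen k n q .a • alpha q ℓ i • gen k n q .a ^ (i - 1) • u =
        alpha q ℓ i • gen k n q .a ^ i • u := by
      rcases i with _ | i
      · simp [alpha]
      · rw [gen_smul_smul, ← mul_smul, ← pow_succ']; rfl
    have e4 : ∀ (x y : k) (v : P), x • v + (v - y • v) = (x + (1 - y)) • v := fun x y v => by
      rw [add_smul, sub_smul, one_smul]
    rw [pow_succ', mul_smul, da_smul, ih, h.c_pow hq0, e,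
      gen_smul_smul n q .b, h.b_pow hq0, smul_smul,
      smul_smul, e4, Nat.add_sub_cancel]
    congr 1
    rw [← zpow_add₀ hq0]
    simp only [alpha]
    rw [show ((i + 1 : ℕ) : ℤ) - ℓ = (i : ℤ) + 1 + -ℓ by push_cast; ring,
      show (i : ℤ) - ℓ = (i : ℤ) + -ℓ by ring,
      show (i : ℤ) + 1 - (r.val + ℓ) + (r.val + i) = (i : ℤ) + i + 1 + -ℓ by ring]
    simp only [zpow_add₀ hq0, zpow_natCast, zpow_one]
    field_simp
    ring

end IsHighestWeight

/-- The module `V(ℓ, r)`. -/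
abbrev SimpleMod (hq : IsPrimitiveRoot q n) (hn : 1 < n) (ℓ : ℕ) (hℓ : ℓ ≤ n) (r : ZMod n) :
    Type _ := RepModule (simpleRep hq hn ℓ hℓ r)

/-! ### Simplicity, universal property and classification of the modules `V(ℓ, r)` -/

section SimpleMod

variable (hq : IsPrimitiveRoot q n) (hn : 1 < n) {ℓ : ℕ} (hℓ : ℓ ≤ n) (r : ZMod n)

theorem simpleRep_gen (g : Gen) :
    simpleRep hq hn ℓ hℓ r (gen k n q g) = simpleGen q ℓ r g := lift_gen _ _ g

/-- The vector `v_{i+1}` of `V(ℓ, r)`, which is `0` for `i ≥ ℓ`. -/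
noncomputable def vec (i : ℕ) : SimpleMod hq hn ℓ hℓ r :=
  RepModule.of _ (if h : i < ℓ then Pi.single ⟨i, h⟩ 1 else 0)

theorem vec_of_le {i : ℕ} (h : ℓ ≤ i) : vec hq hn hℓ r i = 0 := by
  rw [vec, dif_neg (by omega), map_zero]

theorem vec_fin (j : Fin ℓ) :
    vec hq hn hℓ r j = RepModule.of (simpleRep hq hn ℓ hℓ r) (Pi.single j 1) := by
  rw [vec, dif_pos j.isLt]

theorem a_vec (i : ℕ) : gen k n q .a • vec hq hn hℓ r i = vec hq hn hℓ r (i + 1) := by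
  by_cases h : i < ℓ
  · rw [vec, dif_pos h, RepModule.smul_of, simpleRep_gen, simpleGen_a]
    rfl
  · rw [vec_of_le _ _ _ _ (by omega), vec_of_le _ _ _ _ (by omega), smul_zero]

theorem b_vec (i : ℕ) :
    gen k n q .b • vec hq hn hℓ r i = q ^ ((r.val : ℤ) + i) • vec hq hn hℓ r i := by
  by_cases h : i < ℓ
  · rw [vec, dif_pos h, RepModule.smul_of, simpleRep_gen, simpleGen_b, map_smul]
    congr 2; simp only; ring
  · rw [vec_of_le _ _ _ _ (by omega), smul_zero, smul_zero]

theorem c_vec (i : ℕ) :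
    gen k n q .c • vec hq hn hℓ r i = q ^ ((i : ℤ) + 1 - (r.val + ℓ)) • vec hq hn hℓ r i := by
  by_cases h : i < ℓ
  · rw [vec, dif_pos h, RepModule.smul_of, simpleRep_gen, simpleGen_c, map_smul]
  · rw [vec_of_le _ _ _ _ (by omega), smul_zero, smul_zero]

theorem alpha_zero : alpha q ℓ 0 = 0 := by simp [alpha]

theorem alpha_self : alpha q ℓ ℓ = 0 := by simp [alpha]

/-- Both ends fit the uniform formula: `α_0 = 0` covers `v_1`, and `α_ℓ(ℓ) = 0` is consistent with
`v_{ℓ+1} = 0`. -/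
theorem d_vec {i : ℕ} (hi : i ≤ ℓ) :
    gen k n q .d • vec hq hn hℓ r i = alpha q ℓ i • vec hq hn hℓ r (i - 1) := by
  by_cases h : i < ℓ
  · rw [vec, dif_pos h, RepModule.smul_of, simpleRep_gen, simpleGen_d]
    split_ifs with h0
    · rw [map_smul, vec, dif_pos (show i - 1 < ℓ by omega)]
    · obtain rfl : i = 0 := by simpa using h0
      rw [alpha_zero, zero_smul, map_zero]
  · obtain rfl : i = ℓ := by omega
    rw [vec_of_le _ _ _ _ le_rfl, alpha_self, smul_zero, zero_smul]

theorem a_pow_vec (i j : ℕ) :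
    gen k n q .a ^ j • vec hq hn hℓ r i = vec hq hn hℓ r (i + j) := by
  induction j with
  | zero => simp
  | succ j ih => rw [pow_succ', mul_smul, ih, a_vec]; rfl

theorem isHighestWeight_vec : IsHighestWeight (q := q) ℓ r (vec hq hn hℓ r 0) where
  a := by rw [a_pow_vec, vec_of_le _ _ _ _ (by omega)]
  b := by simpa using b_vec hq hn hℓ r 0
  c := by simpa using c_vec hq hn hℓ r 0
  d := by rw [d_vec _ _ _ _ (by omega), alpha_zero, zero_smul]

/-- The basis of `V(ℓ, r)`. -/
noncomputable def vecBasis : Module.Basis (Fin ℓ) k (SimpleMod hq hn ℓ hℓ r) :=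
  (Pi.basisFun k (Fin ℓ)).map (RepModule.of (simpleRep hq hn ℓ hℓ r))

theorem vecBasis_apply (j : Fin ℓ) : vecBasis hq hn hℓ r j = vec hq hn hℓ r j := by
  rw [vecBasis, Module.Basis.map_apply, Pi.basisFun_apply, vec_fin]

theorem vecBasis_induction {p : SimpleMod hq hn ℓ hℓ r → Prop} (zero : p 0)
    (add : ∀ x y, p x → p y → p (x + y)) (smul : ∀ (c : k) x, p x → p (c • x))
    (mem : ∀ j, p (vecBasis hq hn hℓ r j)) (x : SimpleMod hq hn ℓ hℓ r) : p x := by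
  rw [← (vecBasis hq hn hℓ r).sum_repr x]
  exact Finset.sum_induction _ p add zero fun i _ => smul _ _ (mem i)

theorem finrank_simpleMod : Module.finrank k (SimpleMod hq hn ℓ hℓ r) = ℓ := by
  rw [Module.finrank_eq_card_basis (vecBasis hq hn hℓ r), Fintype.card_fin]

/-- The `D_n`-linear map `V(ℓ, r) → P` sending `v_1` to a highest weight vector. -/
noncomputable def homOfHighestWeight {u : P} (h : IsHighestWeight (q := q) ℓ r u) :
    SimpleMod hq hn ℓ hℓ r →ₗ[Dn k n q] P :=
  linearMapOfGen ((vecBasis hq hn hℓ r).constr k fun j => gen k n q .a ^ (j : ℕ) • u) (by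
    have hq0 : q ≠ 0 := hq.ne_zero (by omega)
    have hq1 : q - 1 ≠ 0 := sub_ne_zero.2 (hq.ne_one hn)
    set f := (vecBasis hq hn hℓ r).constr k fun j : Fin ℓ => gen k n q .a ^ (j : ℕ) • u
    -- Indices past the basis are included because `a` sends the last basis vector to `vec ℓ = 0`;
    -- there the hypothesis `a ^ ℓ • u = 0` enters.
    have hf : ∀ i, f (vec hq hn hℓ r i) = gen k n q .a ^ i • u := fun i => by
      by_cases hi : i < ℓ
      · have := (vecBasis hq hn hℓ r).constr_basis k
          (fun j : Fin ℓ => gen k n q .a ^ (j : ℕ) • u) ⟨i, hi⟩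
        rwa [vecBasis_apply] at this
      · rw [vec_of_le _ _ _ _ (by omega), map_zero, show i = (i - ℓ) + ℓ by omega, pow_add,
          mul_smul, h.a, smul_zero]
    intro g v
    induction v using vecBasis_induction with
    | zero => simp
    | add x y hx hy => rw [smul_add, map_add, map_add, smul_add, hx, hy]
    | smul c x hx => rw [gen_smul_smul, f.map_smul, f.map_smul, gen_smul_smul, hx]
    | mem j =>
      rw [vecBasis_apply, hf]
      cases g with
      | a => rw [a_vec, hf, pow_succ', mul_smul]
      | b => rw [b_vec, map_smul, hf, h.b_pow hq0]
      | c => rw [c_vec, map_smul, hf, h.c_pow hq0]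
      | d => rw [d_vec _ _ _ _ j.isLt.le, map_smul, hf, h.d_pow hq0 hq1])

theorem homOfHighestWeight_vec {u : P} (h : IsHighestWeight (q := q) ℓ r u) (hℓ0 : 0 < ℓ) :
    homOfHighestWeight hq hn hℓ r h (vec hq hn hℓ r 0) = u := by
  have := (vecBasis hq hn hℓ r).constr_basis k
    (fun j : Fin ℓ => gen k n q .a ^ (j : ℕ) • u) ⟨0, hℓ0⟩
  rw [vecBasis_apply, pow_zero, one_smul] at this
  exact this

theorem alpha_ne_zero (hq : IsPrimitiveRoot q n) (hn : 1 < n) (hℓ : ℓ ≤ n) {i : ℕ} (h0 : 0 < i)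
    (hi : i < ℓ) : alpha q ℓ i ≠ 0 := by
  have hq0 : q ≠ 0 := hq.ne_zero (by omega)
  refine div_ne_zero (mul_ne_zero ?_ ?_) (sub_ne_zero.2 (hq.ne_one hn))
  · exact sub_ne_zero.2 (hq.pow_ne_one_of_pos_of_lt (by omega) (by omega))
  · refine sub_ne_zero.2 fun h => hq.pow_ne_one_of_pos_of_lt (l := ℓ - i) (by omega) (by omega) ?_
    rw [← zpow_natCast, Nat.cast_sub hi.le, ← neg_sub (i : ℤ), zpow_neg, ← h, inv_one]

/-- In coordinates `d` is a weighted shift; as the weights are nonzero, its kernel is the line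
through `v_1`. -/
theorem d_repr (x : SimpleMod hq hn ℓ hℓ r) (i : Fin ℓ) (hi : (i : ℕ) + 1 < ℓ) :
    (vecBasis hq hn hℓ r).repr (gen k n q .d • x) i =
      alpha q ℓ (i + 1) * (vecBasis hq hn hℓ r).repr x ⟨i + 1, hi⟩ := by
  induction x using vecBasis_induction with
  | zero => simp
  | add x y hx hy => simp [smul_add, hx, hy, mul_add]
  | smul c x hx => rw [gen_smul_smul]; simp [hx, mul_left_comm]
  | mem j =>
    rw [Module.Basis.repr_self, vecBasis_apply, d_vec _ _ _ _ j.isLt.le]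
    rcases Nat.eq_zero_or_pos (j : ℕ) with h0 | h0
    · rw [h0, alpha_zero, zero_smul, map_zero, Finsupp.zero_apply, Finsupp.single_apply,
        if_neg, mul_zero]
      rintro rfl
      simp at h0
    · have := vecBasis_apply hq hn hℓ r ⟨j - 1, by omega⟩
      rw [← this, map_smul, Module.Basis.repr_self, Finsupp.smul_apply, Finsupp.single_apply,
        Finsupp.single_apply]
      by_cases h : (j : ℕ) = i + 1
      · rw [if_pos (Fin.ext (by simp; omega)), if_pos (Fin.ext (by simp; omega)), h, smul_eq_mul]
      · rw [if_neg fun h' => h (by rw [Fin.ext_iff] at h'; simp at h'; omega),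
          if_neg fun h' => h (by rw [Fin.ext_iff] at h'; simpa using h'), smul_zero, mul_zero]

theorem eq_smul_vec_zero (hℓ0 : 0 < ℓ) (x : SimpleMod hq hn ℓ hℓ r)
    (hx : ∀ i : Fin ℓ, 0 < (i : ℕ) → (vecBasis hq hn hℓ r).repr x i = 0) :
    x = (vecBasis hq hn hℓ r).repr x ⟨0, hℓ0⟩ • vec hq hn hℓ r 0 := by
  conv_lhs => rw [← (vecBasis hq hn hℓ r).sum_repr x]
  rw [Finset.sum_eq_single ⟨0, hℓ0⟩ _ (by simp), vecBasis_apply]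
  intro b _ hb
  rw [hx b, zero_smul]
  refine Nat.pos_of_ne_zero fun h => hb (Fin.ext h)

/-- Applying `d` lowers the top index of the support by exactly one, since `α_i(ℓ) ≠ 0` for `0 < i <
ℓ`. Induction on a bound `m` for that index ends at a nonzero multiple of `v_1`. -/
theorem vec_zero_mem (hℓ0 : 0 < ℓ) (N : Submodule (Dn k n q) (SimpleMod hq hn ℓ hℓ r)) (m : ℕ) :
    ∀ x ∈ N, x ≠ 0 → (∀ i : Fin ℓ, m < (i : ℕ) → (vecBasis hq hn hℓ r).repr x i = 0) →
      vec hq hn hℓ r 0 ∈ N := by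
  induction m with
  | zero =>
    intro x hx hx0 hm
    have e := eq_smul_vec_zero hq hn hℓ r hℓ0 x hm
    set c := (vecBasis hq hn hℓ r).repr x ⟨0, hℓ0⟩
    have hc : c ≠ 0 := by
      rintro hc
      rw [hc, zero_smul] at e
      exact hx0 e
    have h2 := N.smul_of_tower_mem c⁻¹ hx
    rwa [e, smul_smul, inv_mul_cancel₀ hc, one_smul] at h2
  | succ m ih =>
    intro x hx hx0 hm
    by_cases h : ∀ i : Fin ℓ, m < (i : ℕ) → (vecBasis hq hn hℓ r).repr x i = 0
    · exact ih x hx hx0 h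
    · push Not at h
      obtain ⟨i, hi, hne⟩ := h
      have him : (i : ℕ) = m + 1 := by
        by_contra h
        exact hne (hm i (by omega))
      refine ih _ (N.smul_mem (gen k n q .d) hx) (fun h => ?_) fun j hj => ?_
      · have := d_repr hq hn hℓ r x ⟨m, by omega⟩ (by simp; omega)
        rw [h, map_zero, Finsupp.zero_apply, eq_comm] at this
        refine (mul_ne_zero (alpha_ne_zero hq hn hℓ (by omega) (by simp; omega)) ?_) this
        convert hne using 3
        exact him.symm
      · by_cases hjl : (j : ℕ) + 1 < ℓ
        · rw [d_repr hq hn hℓ r x j hjl, hm _ (by simp; omega), mul_zero]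
        · rw [← (vecBasis hq hn hℓ r).sum_repr x, Finset.smul_sum, map_sum, Finsupp.finsetSum_apply]
          refine Finset.sum_eq_zero fun i _ => ?_
          rw [gen_smul_smul, vecBasis_apply, d_vec _ _ _ _ i.isLt.le]
          have := vecBasis_apply hq hn hℓ r ⟨i - 1, by omega⟩
          rw [← this, map_smul, map_smul, Module.Basis.repr_self, Finsupp.smul_apply,
            Finsupp.smul_apply, Finsupp.single_apply]
          split_ifs with hij
          · have h0 : (i : ℕ) = 0 := by rw [Fin.ext_iff] at hij; simp at hij; omega
            rw [h0, alpha_zero, zero_smul, smul_zero]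
          · simp

/-- Every nonzero submodule contains `v_1`, and the powers of `a` carry `v_1` to all basis vectors.
-/
theorem isSimpleModule_simpleMod (hℓ0 : 0 < ℓ) :
    IsSimpleModule (Dn k n q) (SimpleMod hq hn ℓ hℓ r) := by
  have : Nontrivial (SimpleMod hq hn ℓ hℓ r) := by
    apply Module.nontrivial_of_finrank_pos (R := k)
    rw [finrank_simpleMod]; exact hℓ0
  refine { eq_bot_or_eq_top := fun N => ?_ }
  rw [or_iff_not_imp_left]
  intro hN
  obtain ⟨x, hx, hx0⟩ := (Submodule.ne_bot_iff N).1 hN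
  have h0 := vec_zero_mem hq hn hℓ r hℓ0 N ℓ x hx hx0 fun i hi => by omega
  rw [eq_top_iff]
  rintro y -
  rw [← (vecBasis hq hn hℓ r).sum_repr y]
  refine N.sum_mem fun i _ => N.smul_of_tower_mem _ ?_
  rw [vecBasis_apply, ← zero_add (i : ℕ), ← a_pow_vec]
  exact N.smul_mem _ h0

theorem pow_val_injective (hq : IsPrimitiveRoot q n) [NeZero n] {r s : ZMod n}
    (h : q ^ r.val = q ^ s.val) : r = s :=
  ZMod.val_injective n (hq.pow_inj r.val_lt s.val_lt h)

/-- The dimension recovers `ℓ`. The kernel of `d` is a line on which `b` acts by `q^r`, and this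
recovers `r` because `q` is primitive. -/
theorem simpleMod_equiv_iff [NeZero n] {ℓ' : ℕ} (hℓ' : ℓ' ≤ n) (s : ZMod n) (hℓ0 : 0 < ℓ) :
    Nonempty (SimpleMod hq hn ℓ hℓ r ≃ₗ[Dn k n q] SimpleMod hq hn ℓ' hℓ' s) ↔
      ℓ = ℓ' ∧ r = s := by
  constructor
  · rintro ⟨e⟩
    have h1 := (e.restrictScalars k).finrank_eq
    rw [finrank_simpleMod, finrank_simpleMod] at h1
    subst h1
    refine ⟨rfl, pow_val_injective hq ?_⟩
    set x := e (vec hq hn hℓ r 0)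
    have hv := isHighestWeight_vec hq hn hℓ r
    have hx0 : x ≠ 0 := by
      intro h
      have h2 : vec hq hn hℓ r 0 = 0 := e.map_eq_zero_iff.1 h
      rw [show (0 : ℕ) = ((⟨0, hℓ0⟩ : Fin ℓ) : ℕ) from rfl, ← vecBasis_apply] at h2
      exact (vecBasis hq hn hℓ r).ne_zero _ h2
    have hd : gen k n q .d • x = 0 := by rw [← map_smul, hv.d, map_zero]
    have hb : gen k n q .b • x = q ^ (r.val : ℤ) • x := by
      rw [← map_smul, hv.b]; exact (e.restrictScalars k).map_smul _ _
    have hx := eq_smul_vec_zero hq hn hℓ' s hℓ0 x fun i hi => by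
      have := d_repr hq hn hℓ' s x ⟨i - 1, by omega⟩ (by simp; omega)
      rw [hd, map_zero, Finsupp.zero_apply, eq_comm] at this
      have h2 := (mul_eq_zero.1 this).resolve_left
        (alpha_ne_zero hq hn hℓ (by omega) (by simp; omega))
      convert h2 using 3
      simp; omega
    have hb' : gen k n q .b • x = q ^ (s.val : ℤ) • x := by
      rw [hx, gen_smul_smul, b_vec, smul_comm]; simp
    rw [hb'] at hb
    have := smul_left_injective k hx0 hb
    rwa [zpow_natCast, zpow_natCast, eq_comm] at this
  · rintro ⟨rfl, rfl⟩
    exact ⟨LinearEquiv.refl _ _⟩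

end SimpleMod

end Dn

/-! ### The generators acting on pure tensors -/

section Tensor

variable {k : Type*} [Field k] {n : ℕ} {q : k} (hq : IsPrimitiveRoot q n) (hn0 : 0 < n)
  {V W : Type*} [AddCommGroup V] [Module k V] [AddCommGroup W] [Module k W]
  (ρ : Dn k n q →ₐ[k] Module.End k V) (σ : Dn k n q →ₐ[k] Module.End k W)

/-- The pure tensors in the tensor product of two `D_n`-modules. -/
def tmul : RepModule ρ →ₗ[k] RepModule σ →ₗ[k] RepModule (tensorRep hq hn0 ρ σ) :=
  TensorProduct.mk k V W

theorem tensorRep_gen (g : Gen) : tensorRep hq hn0 ρ σ (gen k n q g) =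
    Module.endTensorEndAlgHom (R := k) (S := k) (A := k) (M := V) (N := W)
      (Algebra.TensorProduct.map ρ σ (comulGen k n q g)) := by
  simp only [tensorRep, AlgHom.comp_apply]
  rw [comul, lift_gen]

variable (v : RepModule ρ) (w : RepModule σ)

theorem a_tmul : gen k n q .a • tmul hq hn0 ρ σ v w =
    tmul hq hn0 ρ σ (gen k n q .a • v) (gen k n q .b • w) +
      tmul hq hn0 ρ σ v (gen k n q .a • w) := by
  change tensorRep hq hn0 ρ σ (gen k n q .a) (v ⊗ₜ[k] w) = _
  rw [tensorRep_gen]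
  simp only [comulGen, map_add, Algebra.TensorProduct.map_tmul, map_one, LinearMap.add_apply,
    Module.endTensorEndAlgHom_apply]
  rfl

theorem d_tmul : gen k n q .d • tmul hq hn0 ρ σ v w =
    tmul hq hn0 ρ σ (gen k n q .d • v) (gen k n q .c • w) +
      tmul hq hn0 ρ σ v (gen k n q .d • w) := by
  change tensorRep hq hn0 ρ σ (gen k n q .d) (v ⊗ₜ[k] w) = _
  rw [tensorRep_gen]
  simp only [comulGen, map_add, Algebra.TensorProduct.map_tmul, map_one, LinearMap.add_apply,
    Module.endTensorEndAlgHom_apply]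
  rfl

theorem b_tmul : gen k n q .b • tmul hq hn0 ρ σ v w =
    tmul hq hn0 ρ σ (gen k n q .b • v) (gen k n q .b • w) := by
  change tensorRep hq hn0 ρ σ (gen k n q .b) (v ⊗ₜ[k] w) = _
  rw [tensorRep_gen]
  simp only [comulGen, Algebra.TensorProduct.map_tmul,
    Module.endTensorEndAlgHom_apply]
  rfl

theorem c_tmul : gen k n q .c • tmul hq hn0 ρ σ v w =
    tmul hq hn0 ρ σ (gen k n q .c • v) (gen k n q .c • w) := by
  change tensorRep hq hn0 ρ σ (gen k n q .c) (v ⊗ₜ[k] w) = _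
  rw [tensorRep_gen]
  simp only [comulGen, Algebra.TensorProduct.map_tmul,
    Module.endTensorEndAlgHom_apply]
  rfl

end Tensor

/-! ### Explicit formulas in `V(ℓ, r) ⊗ V(2, 0)` -/

section TensorTwo

variable {k : Type*} [Field k] {n : ℕ} {q : k} (hq : IsPrimitiveRoot q n) (hn : 1 < n)
  {ℓ : ℕ} (hℓ : ℓ ≤ n) (r : ZMod n)

/-- The module `V(ℓ, r) ⊗ V(2, 0)`. -/
abbrev TensorTwo : Type _ :=
  RepModule (tensorRep hq (Nat.zero_lt_of_lt hn) (simpleRep hq hn ℓ hℓ r) (simpleRep hq hn 2 hn 0))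

/-- The vector `v_{i+1} ⊗ v_{j+1}` of `V(ℓ, r) ⊗ V(2, 0)`. -/
noncomputable def ten (i j : ℕ) : TensorTwo hq hn hℓ r :=
  tmul hq _ _ _ (vec hq hn hℓ r i) (vec hq hn hn 0 j)

theorem ten_left_of_le {i : ℕ} (h : ℓ ≤ i) (j : ℕ) : ten hq hn hℓ r i j = 0 := by
  rw [ten, vec_of_le _ _ _ _ h, map_zero, LinearMap.zero_apply]

theorem a_ten_zero (i : ℕ) : gen k n q .a • ten hq hn hℓ r i 0 =
    ten hq hn hℓ r (i + 1) 0 + ten hq hn hℓ r i 1 := by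
  have : NeZero n := ⟨by omega⟩
  rw [ten, a_tmul, a_vec, b_vec, a_vec]
  simp [ten]

theorem a_ten_one (i : ℕ) : gen k n q .a • ten hq hn hℓ r i 1 =
    q • ten hq hn hℓ r (i + 1) 1 := by
  have : NeZero n := ⟨by omega⟩
  rw [ten, a_tmul, a_vec, b_vec, a_vec, vec_of_le hq hn hn 0 (i := 1 + 1) le_rfl]
  simp [ten]

theorem b_ten (i j : ℕ) : gen k n q .b • ten hq hn hℓ r i j =
    q ^ ((r.val : ℤ) + i + j) • ten hq hn hℓ r i j := by
  have : NeZero n := ⟨by omega⟩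
  have hq0 : q ≠ 0 := hq.ne_zero (by omega)
  rw [ten, b_tmul, b_vec, b_vec, map_smul, map_smul, LinearMap.smul_apply, smul_smul,
    ← zpow_add₀ hq0]
  congr 2
  simp; ring

theorem c_ten (i j : ℕ) : gen k n q .c • ten hq hn hℓ r i j =
    q ^ ((i : ℤ) + j - (r.val + ℓ)) • ten hq hn hℓ r i j := by
  have : NeZero n := ⟨by omega⟩
  have hq0 : q ≠ 0 := hq.ne_zero (by omega)
  rw [ten, c_tmul, c_vec, c_vec, map_smul, map_smul, LinearMap.smul_apply, smul_smul,
    ← zpow_add₀ hq0]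
  congr 2
  simp; ring

theorem d_ten_zero {i : ℕ} (hi : i ≤ ℓ) : gen k n q .d • ten hq hn hℓ r i 0 =
    (alpha q ℓ i * q⁻¹) • ten hq hn hℓ r (i - 1) 0 := by
  have : NeZero n := ⟨by omega⟩
  rw [ten, d_tmul, d_vec _ _ _ _ hi, c_vec, d_vec _ _ _ _ (by omega), alpha_zero]
  have e : q ^ (((0 : ℕ) : ℤ) + 1 - ((0 : ZMod n).val + (2 : ℕ))) = q⁻¹ := by
    rw [← zpow_neg_one]
    congr 1
    simp
  rw [e, zero_smul, map_zero, add_zero, map_smul, map_smul, LinearMap.smul_apply, smul_smul,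
    mul_comm]
  rfl

theorem d_ten_one {i : ℕ} (hi : i ≤ ℓ) : gen k n q .d • ten hq hn hℓ r i 1 =
    alpha q ℓ i • ten hq hn hℓ r (i - 1) 1 + (1 - q⁻¹) • ten hq hn hℓ r i 0 := by
  have : NeZero n := ⟨by omega⟩
  have hq1 : q - 1 ≠ 0 := sub_ne_zero.2 (hq.ne_one hn)
  rw [ten, d_tmul, d_vec _ _ _ _ hi, c_vec, d_vec _ _ _ _ (by omega)]
  have e : q ^ (((1 : ℕ) : ℤ) + 1 - ((0 : ZMod n).val + (2 : ℕ))) = 1 := by simp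
  have e2 : alpha q 2 1 = 1 - q⁻¹ := by
    rw [alpha]
    norm_num
    field_simp
  rw [e, e2, one_smul, map_smul, map_smul, LinearMap.smul_apply]
  rfl

theorem a_pow_ten_one (m : ℕ) : gen k n q .a ^ m • ten hq hn hℓ r 0 1 =
    q ^ m • ten hq hn hℓ r m 1 := by
  induction m with
  | zero => simp
  | succ m ih => rw [pow_succ', mul_smul, ih, gen_smul_smul, a_ten_one, smul_smul, pow_succ]

/-- The coefficient is the quantum integer `[m+1]`. It is nonzero for `m + 1 < n` and zero for `m +
1 = n`, which separates the cases `ℓ < n` and `ℓ = n`. -/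
theorem a_pow_ten_zero (m : ℕ) : gen k n q .a ^ (m + 1) • ten hq hn hℓ r 0 0 =
    ten hq hn hℓ r (m + 1) 0 + ((q ^ (m + 1) - 1) / (q - 1)) • ten hq hn hℓ r m 1 := by
  have hq1 : q - 1 ≠ 0 := sub_ne_zero.2 (hq.ne_one hn)
  induction m with
  | zero => rw [zero_add, pow_one, pow_one, div_self hq1, one_smul, a_ten_zero, zero_add]
  | succ m ih =>
    rw [pow_succ', mul_smul, ih, smul_add, a_ten_zero, gen_smul_smul, a_ten_one, add_assoc,
      smul_smul]
    congr 1
    nth_rw 1 [← one_smul k (ten hq hn hℓ r (m + 1) 1)]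
    rw [← add_smul]
    congr 1
    field_simp
    ring

theorem finrank_tensorTwo : Module.finrank k (TensorTwo hq hn hℓ r) = ℓ + ℓ := by
  have : Module.finrank k ((Fin ℓ → k) ⊗[k] (Fin 2 → k)) = ℓ * 2 := by simp
  rw [← mul_two]
  exact this

/-- Powers of `a` on `t 0 1` give every `t i 1` up to a unit; then `a • t i 0 - t i 1 = t (i+1) 0`
gives the rest. -/
theorem eq_top_of_ten_mem {N : Submodule (Dn k n q) (TensorTwo hq hn hℓ r)}
    (h0 : ten hq hn hℓ r 0 0 ∈ N) (h1 : ten hq hn hℓ r 0 1 ∈ N) : N = ⊤ := by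
  have hq0 : q ≠ 0 := hq.ne_zero (by omega)
  have H1 : ∀ i, ten hq hn hℓ r i 1 ∈ N := fun i => by
    have := N.smul_of_tower_mem (q ^ i)⁻¹ (N.smul_mem (gen k n q .a ^ i) h1)
    rwa [a_pow_ten_one, smul_smul, inv_mul_cancel₀ (pow_ne_zero _ hq0), one_smul] at this
  have H0 : ∀ i, ten hq hn hℓ r i 0 ∈ N := fun i => by
    induction i with
    | zero => exact h0
    | succ i ih =>
      have := N.sub_mem (N.smul_mem (gen k n q .a) ih) (H1 i)
      rwa [a_ten_zero, add_sub_cancel_right] at this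
  have H : ∀ (v : SimpleMod hq hn ℓ hℓ r) (w : SimpleMod hq hn 2 hn 0),
      tmul hq (Nat.zero_lt_of_lt hn) _ _ v w ∈ N := by
    intro v w
    induction v using vecBasis_induction with
    | zero => simp
    | add x y hx hy => rw [map_add, LinearMap.add_apply]; exact N.add_mem hx hy
    | smul c x hx =>
      rw [map_smul, LinearMap.smul_apply]; exact N.smul_of_tower_mem _ hx
    | mem i =>
      induction w using vecBasis_induction with
      | zero => simp
      | add x y hx hy => rw [map_add]; exact N.add_mem hx hy
      | smul c x hx =>
        rw [map_smul]; exact N.smul_of_tower_mem _ hx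
      | mem j =>
        rw [vecBasis_apply, vecBasis_apply]
        fin_cases j
        · exact H0 i
        · exact H1 i
  rw [eq_top_iff]
  rintro x -
  change (Fin ℓ → k) ⊗[k] (Fin 2 → k) at x
  induction x using TensorProduct.induction_on with
  | zero => exact N.zero_mem
  | tmul v w => exact H v w
  | add x y hx hy => exact N.add_mem hx hy

end TensorTwo

/-! ### Composition factors of `V(ℓ, r) ⊗ V(2, 0)` and the block form -/

section Factors

variable {k : Type*} [Field k] {n : ℕ} {q : k} (hq : IsPrimitiveRoot q n) (hn : 1 < n)

/-- One step of the filtration. Only the vanishing conditions are taken modulo `N`; the weights hold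
exactly. Keeping `N ≤ N'` and `u ∈ N'` lets later steps verify their own conditions modulo `N'`. -/
theorem FactorBound.step_highestWeight [NeZero n] {M : Type*} [AddCommGroup M]
    [Module (Dn k n q) M]
    [Module k M] [IsScalarTower k (Dn k n q) M] [FiniteDimensional k M]
    {ℓ₀ : ℕ} {hℓ₀ : ℓ₀ ≤ n} {s : ZMod n} {N : Submodule (Dn k n q) M} {c D : ℕ}
    (h : FactorBound k (SimpleMod hq hn ℓ₀ hℓ₀ s) N c D) {ℓ : ℕ} (hℓ0 : 0 < ℓ) (hℓ : ℓ ≤ n)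
    (r : ZMod n) (u : M) (ha : gen k n q .a ^ ℓ • u ∈ N)
    (hb : gen k n q .b • u = q ^ (r.val : ℤ) • u)
    (hc : gen k n q .c • u = q ^ (1 - (r.val + ℓ : ℤ)) • u) (hd : gen k n q .d • u ∈ N) :
    ∃ N' : Submodule (Dn k n q) M, N ≤ N' ∧ u ∈ N' ∧
      FactorBound k (SimpleMod hq hn ℓ₀ hℓ₀ s) N'
        (c + if ℓ = ℓ₀ ∧ r = s then 1 else 0) (D + ℓ) := by
  have hu : IsHighestWeight (q := q) ℓ r (N.mkQ u) :=
    { a := by rw [← map_smul]; exact (Submodule.Quotient.mk_eq_zero N).2 ha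
      b := by rw [← map_smul, hb]; rfl
      c := by rw [← map_smul, hc]; rfl
      d := by rw [← map_smul]; exact (Submodule.Quotient.mk_eq_zero N).2 hd }
  have := isSimpleModule_simpleMod hq hn hℓ r hℓ0
  have h2 := h.step (homOfHighestWeight hq hn hℓ r hu)
  rw [finrank_simpleMod] at h2
  refine ⟨(LinearMap.range (homOfHighestWeight hq hn hℓ r hu)).comap N.mkQ, fun x hx => ?_, ?_, ?_⟩
  rotate_left 2
  · simpa only [simpleMod_equiv_iff hq hn hℓ r hℓ₀ s hℓ0] using h2
  · rw [Submodule.mem_comap, show N.mkQ x = 0 from (Submodule.Quotient.mk_eq_zero N).2 hx]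
    exact zero_mem _
  · exact ⟨_, homOfHighestWeight_vec hq hn hℓ r hu hℓ0⟩

/-- Weights use the representatives `r.val`, so `r + 1` may wrap around; comparing exponents modulo
`n` absorbs this. -/
theorem zpow_eq_zpow_of_dvd (hq : IsPrimitiveRoot q n) (hn : 1 < n) {x y : ℤ}
    (h : (n : ℤ) ∣ x - y) : q ^ x = q ^ y := by
  have hq0 : q ≠ 0 := hq.ne_zero (by omega)
  rw [← sub_add_cancel x y, zpow_add₀ hq0, (hq.zpow_eq_one_iff_dvd _).2 h, one_mul]

theorem exists_val_add_one (r : ZMod n) [NeZero n] :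
    ∃ z : ℤ, ((r + 1).val : ℤ) = r.val + 1 + n * z := by
  have : (((r + 1).val : ℤ) : ZMod n) = ((r.val + 1 : ℤ) : ZMod n) := by simp
  obtain ⟨z, hz⟩ := (ZMod.intCast_eq_intCast_iff_dvd_sub _ _ _).1 this.symm
  exact ⟨z, by linarith⟩

theorem compMult_tensorTwo_of_lt [NeZero n] {ℓ : ℕ} (hℓ0 : 0 < ℓ) (hℓ : ℓ < n) (r : ZMod n)
    {ℓ₀ : ℕ} (hℓ₀0 : 0 < ℓ₀) (hℓ₀ : ℓ₀ ≤ n) (s : ZMod n) :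
    compMult (Dn k n q) (TensorTwo hq hn hℓ.le r) (SimpleMod hq hn ℓ₀ hℓ₀ s) =
      (if ℓ + 1 = ℓ₀ ∧ r = s then 1 else 0) + if ℓ - 1 = ℓ₀ ∧ r + 1 = s then 1 else 0 := by
  have hq0 : q ≠ 0 := hq.ne_zero (by omega)
  have hq1 : q - 1 ≠ 0 := sub_ne_zero.2 (hq.ne_one hn)
  have h0 := factorBound_bot (k := k) (A := Dn k n q) (M := TensorTwo hq hn hℓ.le r)
    (SimpleMod hq hn ℓ₀ hℓ₀ s)
  obtain ⟨N₁, -, hu₁, h1⟩ := h0.step_highestWeight hq hn (ℓ := ℓ + 1) (by omega) hℓ r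
    (ten hq hn hℓ.le r 0 0)
    (by
      rw [pow_succ', mul_smul]
      obtain ⟨m, rfl⟩ : ∃ m, ℓ = m + 1 := ⟨ℓ - 1, by omega⟩
      rw [a_pow_ten_zero, ten_left_of_le _ _ _ _ le_rfl, zero_add, gen_smul_smul, a_ten_one,
        ten_left_of_le _ _ _ _ le_rfl, smul_zero, smul_zero]
      exact zero_mem _)
    (by rw [b_ten]; simp)
    (by rw [c_ten]; congr 2; push_cast; ring)
    (by rw [d_ten_zero _ _ _ _ (by omega), alpha_zero, zero_mul, zero_smul]; exact zero_mem _)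
  -- `a ^ ℓ • t 0 0 = [ℓ] t (ℓ-1) 1`, and `[ℓ]` is invertible because `ℓ < n`.
  have hlast : ten hq hn hℓ.le r (ℓ - 1) 1 ∈ N₁ := by
    have h2 := N₁.smul_mem (gen k n q .a ^ (ℓ - 1 + 1)) hu₁
    rw [a_pow_ten_zero, ten_left_of_le _ _ _ _ (i := ℓ - 1 + 1) (by omega), zero_add] at h2
    have hne : (q ^ (ℓ - 1 + 1) - 1) / (q - 1) ≠ 0 :=
      div_ne_zero (sub_ne_zero.2 (hq.pow_ne_one_of_pos_of_lt (by omega) (by omega))) hq1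
    have h3 := N₁.smul_of_tower_mem ((q ^ (ℓ - 1 + 1) - 1) / (q - 1))⁻¹ h2
    rwa [smul_smul, inv_mul_cancel₀ hne, one_smul] at h3
  -- For `ℓ = 1` the vector `t (ℓ-1) 1` is `t 0 1`, so the first step already fills the space; the
  -- second indicator is zero since `ℓ₀ > 0`.
  rcases Nat.eq_or_lt_of_le (show 1 ≤ ℓ from hℓ0) with rfl | hℓ1
  · rw [h1.compMult_eq (eq_top_of_ten_mem hq hn _ r hu₁ hlast)
      (by rw [finrank_tensorTwo, zero_add]), if_neg (c := 1 - 1 = ℓ₀ ∧ r + 1 = s) (by omega),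
      zero_add, add_zero]
  · obtain ⟨z, hz⟩ := exists_val_add_one r
    obtain ⟨N₂, hN, hu₂, h2⟩ := h1.step_highestWeight hq hn (ℓ := ℓ - 1) (by omega) (by omega)
      (r + 1) (ten hq hn hℓ.le r 0 1)
      (by
        rw [a_pow_ten_one]
        exact N₁.smul_of_tower_mem _ hlast)
      (by
        rw [b_ten]
        congr 1
        refine zpow_eq_zpow_of_dvd hq hn ⟨-z, ?_⟩
        rw [hz]; push_cast; ring)
      (by
        rw [c_ten]
        congr 1
        refine zpow_eq_zpow_of_dvd hq hn ⟨z, ?_⟩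
        rw [hz]; push_cast [Nat.cast_sub hℓ0]; ring)
      (by
        rw [d_ten_one _ _ _ _ (by omega), alpha_zero, zero_smul, zero_add]
        exact N₁.smul_of_tower_mem _ hu₁)
    rw [h2.compMult_eq (eq_top_of_ten_mem hq hn _ r (hN hu₁) hu₂)
      (by rw [finrank_tensorTwo]; omega), zero_add]

/-- As `[n] = 0`, the submodule generated by `t 0 0` no longer contains `t (n-1) 1` for free. The
order of the four steps matters: each vector is sent by `d` and the relevant power of `a` into the
span already built. -/
theorem compMult_tensorTwo_self [NeZero n] (r : ZMod n)
    {ℓ₀ : ℕ} (hℓ₀ : ℓ₀ ≤ n) (s : ZMod n) :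
    compMult (Dn k n q) (TensorTwo hq hn le_rfl r) (SimpleMod hq hn ℓ₀ hℓ₀ s) =
      2 * (if 1 = ℓ₀ ∧ r = s then 1 else 0) + 2 * if n - 1 = ℓ₀ ∧ r + 1 = s then 1 else 0 := by
  have hq0 : q ≠ 0 := hq.ne_zero (by omega)
  have hq1 : q - 1 ≠ 0 := sub_ne_zero.2 (hq.ne_one hn)
  obtain ⟨z, hz⟩ := exists_val_add_one r
  have hn1 : n - 1 + 1 = n := by omega
  have hqn : q ^ n = 1 := hq.pow_eq_one
  have hqn' : q ^ (n - 1) = q⁻¹ := by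
    refine eq_inv_of_mul_eq_one_left ?_
    rw [← pow_succ, hn1, hqn]
  set t := ten hq hn (le_refl n) r
  have h0 := factorBound_bot (k := k) (A := Dn k n q) (M := TensorTwo hq hn le_rfl r)
    (SimpleMod hq hn ℓ₀ hℓ₀ s)
  have hat : gen k n q .a • t 0 0 = t 1 0 + t 0 1 := a_ten_zero hq hn le_rfl r 0
  obtain ⟨N₁, -, hu₁, h1⟩ := h0.step_highestWeight hq hn (ℓ := n - 1) (by omega) (by omega)
    (r + 1) (t 1 0 + t 0 1)
    (by
      rw [← hat, ← mul_smul, ← pow_succ, a_pow_ten_zero, hn1, hqn, sub_self, zero_div, zero_smul,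
        ten_left_of_le _ _ _ _ le_rfl, zero_add]
      exact zero_mem _)
    (by
      rw [smul_add, b_ten, b_ten, smul_add]
      congr 2 <;> refine zpow_eq_zpow_of_dvd hq hn ⟨-z, ?_⟩ <;> rw [hz] <;> push_cast <;> ring)
    (by
      rw [smul_add, c_ten, c_ten, smul_add]
      congr 2 <;> refine zpow_eq_zpow_of_dvd hq hn ⟨z, ?_⟩ <;> rw [hz] <;>
        push_cast [Nat.cast_sub hn.le] <;> ring)
    (by
      rw [smul_add, d_ten_zero _ _ _ _ (by omega), d_ten_one _ _ _ _ (by omega), alpha_zero,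
        zero_smul, zero_add, ← add_smul]
      -- Here `q^n = 1` gives `α_1(n) = 1 - q`, so `d` kills `a • t 0 0`.
      have : alpha q n 1 * q⁻¹ + (1 - q⁻¹) = 0 := by
        rw [alpha, zpow_sub₀ hq0, zpow_natCast, zpow_natCast, hqn]
        field_simp
        ring
      rw [this, zero_smul]
      exact zero_mem _)
  obtain ⟨N₂, hN₂, hu₂, h2⟩ := h1.step_highestWeight hq hn (ℓ := 1) (by omega) (by omega) r (t 0 0)
    (by rwa [pow_one, hat])
    (by
      rw [b_ten]
      congr 2)
    (by
      rw [c_ten]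
      congr 1
      refine zpow_eq_zpow_of_dvd hq hn ⟨-1, ?_⟩
      push_cast; ring)
    (by rw [d_ten_zero _ _ _ _ (by omega), alpha_zero, zero_mul, zero_smul]; exact zero_mem _)
  obtain ⟨N₃, hN₃, hu₃, h3⟩ := h2.step_highestWeight hq hn (ℓ := 1) (by omega) (by omega) r
    (t (n - 1) 1)
    (by
      rw [pow_one, a_ten_one, hn1, ten_left_of_le _ _ _ _ le_rfl, smul_zero]
      exact zero_mem _)
    (by
      rw [b_ten]
      congr 1
      refine zpow_eq_zpow_of_dvd hq hn ⟨1, ?_⟩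
      push_cast [Nat.cast_sub hn.le]; ring)
    (by
      rw [c_ten]
      congr 1
      refine zpow_eq_zpow_of_dvd hq hn ⟨0, ?_⟩
      push_cast [Nat.cast_sub hn.le]; ring)
    (by
      -- `d • t (n-1) 1` equals `(1 - q⁻¹) a ^ (n-1) • t 0 0`, because `α_{n-1}(n) = (1 - q⁻¹)
      -- [n-1]`.
      have h4 := N₂.smul_of_tower_mem (1 - q⁻¹) (N₂.smul_mem (gen k n q .a ^ (n - 2 + 1)) hu₂)
      rw [a_pow_ten_zero, show n - 2 + 1 = n - 1 by omega, hqn', smul_add, smul_smul,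
        add_comm] at h4
      rw [d_ten_one _ _ _ _ (by omega)]
      rw [show n - 1 - 1 = n - 2 by omega]
      convert h4 using 3
      rw [alpha, Nat.cast_sub hn.le, hqn']
      rw [show ((n : ℤ) - (1 : ℕ) - n) = -1 by push_cast; ring, zpow_neg_one]
      ring)
  obtain ⟨N₄, hN₄, hu₄, h4⟩ := h3.step_highestWeight hq hn (ℓ := n - 1) (by omega) (by omega)
    (r + 1) (t 0 1)
    (by
      rw [a_pow_ten_one]
      exact N₃.smul_of_tower_mem _ hu₃)
    (by
      rw [b_ten]
      congr 1
      refine zpow_eq_zpow_of_dvd hq hn ⟨-z, ?_⟩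
      rw [hz]; push_cast; ring)
    (by
      rw [c_ten]
      congr 1
      refine zpow_eq_zpow_of_dvd hq hn ⟨z, ?_⟩
      rw [hz]; push_cast [Nat.cast_sub hn.le]; ring)
    (by
      rw [d_ten_one _ _ _ _ (by omega), alpha_zero, zero_smul, zero_add]
      exact N₃.smul_of_tower_mem _ (hN₃ hu₂))
  rw [h4.compMult_eq (eq_top_of_ten_mem hq hn _ r (hN₄ (hN₃ hu₂)) hu₄)
    (by rw [finrank_tensorTwo]; omega)]
  ring

/-- The McKay matrix for tensoring with `V(2, 0)` in block form. -/
theorem mckayMatrixTwo_eq_blockMatrix [NeZero n] (hn3 : 3 ≤ n) :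
    mckayMatrixTwo hq hn = blockMatrix k n := by
  ext ⟨⟨i, hi⟩, r⟩ ⟨⟨j, hj⟩, s⟩
  simp only [mckayMatrixTwo, Matrix.map_apply, mckayMatrix, Matrix.of_apply, blockMatrix]
  by_cases h : i + 1 < n
  · have e := compMult_tensorTwo_of_lt hq hn (Nat.succ_pos i) h r (Nat.succ_pos j) hj s
    rw [if_pos h]
    refine (congrArg Nat.cast e).trans ?_
    push_cast
    by_cases h1 : j = i + 1
    · simp [h1, Matrix.one_apply, show i ≠ i + 1 + 1 by omega]
    · by_cases h2 : j + 1 = i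
      · subst h2
        simp [cyclicMatrix, eq_comm, show j ≠ j + 1 + 1 by omega]
      · rw [if_neg (by omega), if_neg (by omega), if_neg h1, if_neg h2]
        simp
  · obtain rfl : n = i + 1 := by omega
    have e := compMult_tensorTwo_self hq hn r hj s
    rw [if_neg h]
    refine (congrArg Nat.cast e).trans ?_
    push_cast
    by_cases h1 : j = 0
    · subst h1
      -- With `n ≥ 3` the blocks `2I` and `2Z` of the last row lie in different columns.
      simp [Matrix.one_apply, show i ≠ 1 by omega]
    · by_cases h2 : j + 1 = i
      · subst h2
        simp [cyclicMatrix, h1, eq_comm]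
      · rw [if_neg (by omega), if_neg (by omega), if_neg h1, if_neg h2]
        simp

end Factors

/-! ### Row vectors with blocks proportional to an eigenvector of `Z` -/

section Eigenvectors

variable {k : Type*} [Field k]

theorem blockMatrix_apply {n : ℕ} (hn : 3 ≤ n) (x y : Fin n × ZMod n) :
    blockMatrix k n x y =
      (if (y.1 : ℕ) = 0 then (if (x.1 : ℕ) + 1 = n then 2 else 0)
        else if (x.1 : ℕ) + 1 = y.1 then 1 else 0) * (1 : Matrix (ZMod n) (ZMod n) k) x.2 y.2 +
      (if (x.1 : ℕ) = y.1 + 1 then (if (x.1 : ℕ) + 1 = n then 2 else 1) else 0) *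
        cyclicMatrix k n x.2 y.2 := by
  have hx := x.1.isLt
  have hy := y.1.isLt
  simp only [blockMatrix, Matrix.of_apply]
  split_ifs <;> first | omega | simp

theorem sum_superdiagonal {n : ℕ} (hn : 3 ≤ n) (c : ℕ → k) (i : Fin n) :
    ∑ x : Fin n, c (n - 1 - x) * (if (i : ℕ) = 0 then (if (x : ℕ) + 1 = n then 2 else 0)
      else if (x : ℕ) + 1 = i then 1 else 0) =
      if (i : ℕ) = 0 then 2 * c 0 else c (n - 1 - i + 1) := by
  have hi := i.isLt
  split_ifs with h
  · rw [Finset.sum_eq_single ⟨n - 1, by omega⟩ _ (by simp)]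
    · rw [if_pos (by simp; omega), mul_comm]
      simp
    · intro b _ hb
      rw [if_neg fun h => hb (Fin.ext (by simp; omega)), mul_zero]
  · rw [Finset.sum_eq_single ⟨i - 1, by omega⟩ _ (by simp)]
    · rw [if_pos (by simp; omega), mul_one]
      congr 1; simp; omega
    · intro b _ hb
      rw [if_neg fun h => hb (Fin.ext (by simp; omega)), mul_zero]

/-- Reversed numbering puts `c 0` in the last block row. Hence the doubling appears at column `n -
2`, that is at `m = 1`, while the last column receives nothing from below. -/
theorem sum_subdiagonal {n : ℕ} (c : ℕ → k) (i : Fin n) :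
    ∑ x : Fin n, c (n - 1 - x) *
      (if (x : ℕ) = i + 1 then (if (x : ℕ) + 1 = n then 2 else 1) else 0) =
      if (i : ℕ) + 1 = n then 0 else if (i : ℕ) + 2 = n then 2 * c 0 else c (n - 1 - i - 1) := by
  have hi := i.isLt
  split_ifs with h h'
  · refine Finset.sum_eq_zero fun x _ => ?_
    rw [if_neg (by omega), mul_zero]
  · rw [Finset.sum_eq_single ⟨i + 1, by omega⟩ _ (by simp)]
    · rw [if_pos rfl, if_pos h', mul_comm]
      congr 2; simp; omega
    · intro b _ hb
      rw [if_neg fun h => hb (Fin.ext h), mul_zero]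
  · rw [Finset.sum_eq_single ⟨i + 1, by omega⟩ _ (by simp)]
    · rw [if_pos rfl, if_neg h', mul_one]
      congr 1
    · intro b _ hb
      rw [if_neg fun h => hb (Fin.ext h), mul_zero]

theorem revBlocks_vecMul_blockMatrix_apply {n : ℕ} [NeZero n] (hn : 3 ≤ n) {μ : k}
    {w : ZMod n → k} (hw : w ᵥ* cyclicMatrix k n = μ • w) (c : ℕ → k) (i : Fin n) (s : ZMod n) :
    (revBlocks (fun m => c m • w) ᵥ* blockMatrix k n) (i, s) =
      ((if (i : ℕ) = 0 then 2 * c 0 else c (n - 1 - i + 1)) + μ * (if (i : ℕ) + 1 = n then 0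
        else if (i : ℕ) + 2 = n then 2 * c 0 else c (n - 1 - i - 1))) * w s := by
  have hws : ∑ t, w t * cyclicMatrix k n t s = μ * w s := congrFun hw s
  have h1s : ∑ t, w t * (1 : Matrix (ZMod n) (ZMod n) k) t s = w s :=
    congrFun (Matrix.vecMul_one w) s
  have key : ∀ e a b : k, ∑ t, e * w t *
      (a * (1 : Matrix (ZMod n) (ZMod n) k) t s + b * cyclicMatrix k n t s) =
      (e * a + μ * (e * b)) * w s := fun e a b => by
    calc _ = e * a * (∑ t, w t * (1 : Matrix (ZMod n) (ZMod n) k) t s) +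
          e * b * ∑ t, w t * cyclicMatrix k n t s := by
          rw [Finset.mul_sum, Finset.mul_sum, ← Finset.sum_add_distrib]
          exact Finset.sum_congr rfl fun t _ => by ring
      _ = _ := by rw [h1s, hws]; ring
  have hsum : (revBlocks (fun m => c m • w) ᵥ* blockMatrix k n) (i, s) =
      ∑ x : Fin n, ∑ t, c (n - 1 - x) * w t * blockMatrix k n (x, t) (i, s) :=
    Fintype.sum_prod_type _
  rw [hsum, ← sum_superdiagonal hn, ← sum_subdiagonal, Finset.mul_sum, ← Finset.sum_add_distrib,
    Finset.sum_mul]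
  refine Finset.sum_congr rfl fun x _ => ?_
  rw [← key]
  exact Finset.sum_congr rfl fun t _ => by rw [blockMatrix_apply hn]

/-- The action on row vectors whose blocks are multiples of an eigenvector of `Z`. -/
theorem revBlocks_vecMul_blockMatrix {n : ℕ} [NeZero n] (hn : 3 ≤ n) {μ ν : k} {w : ZMod n → k}
    (hw : w ᵥ* cyclicMatrix k n = μ • w) {c δ : ℕ → k} (h0 : c 1 = ν * c 0 + δ 0)
    (h1 : c 2 + μ * (2 * c 0) = ν * c 1 + δ 1)
    (h2 : ∀ m, c (m + 3) + μ * c (m + 1) = ν * c (m + 2) + δ (m + 2))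
    (h3 : μ * c (n - 2) + 2 * c 0 = ν * c (n - 1) + δ (n - 1)) :
    revBlocks (fun m => c m • w) ᵥ* blockMatrix k n =
      ν • revBlocks (fun m => c m • w) + revBlocks (fun m => δ m • w) := by
  ext ⟨i, s⟩
  have hi := i.isLt
  rw [revBlocks_vecMul_blockMatrix_apply hn hw]
  have e : (ν • revBlocks (fun m => c m • w) + revBlocks (fun m => δ m • w)) (i, s) =
      (ν * c (n - 1 - i) + δ (n - 1 - i)) * w s := by
    simp only [revBlocks, Pi.add_apply, Pi.smul_apply, smul_eq_mul]
    ring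
  rw [e]
  congr 1
  by_cases hi0 : (i : ℕ) = 0
  · rw [if_pos hi0, if_neg (by omega), if_neg (by omega), hi0, Nat.sub_zero,
      show n - 1 - 1 = n - 2 by omega, add_comm, h3]
  · rw [if_neg hi0]
    by_cases hi1 : (i : ℕ) + 1 = n
    · rw [if_pos hi1, show n - 1 - (i : ℕ) = 0 by omega, mul_zero, add_zero, zero_add, h0]
    · rw [if_neg hi1]
      by_cases hi2 : (i : ℕ) + 2 = n
      · rw [if_pos hi2, show n - 1 - (i : ℕ) = 1 by omega, h1]
      · rw [if_neg hi2]
        obtain ⟨m, hm⟩ : ∃ m, n - 1 - (i : ℕ) = m + 2 := ⟨n - 1 - i - 2, by omega⟩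
        rw [hm]
        exact h2 m

/-! ### Chebyshev identities -/

theorem chebL_zero (t : k) : chebL 0 t = 2 := by simp [chebL]

theorem chebL_one (t : k) : chebL 1 t = t := by simp [chebL]

theorem chebL_add_two (m : ℕ) (t : k) :
    chebL (m + 2) t = t * chebL (m + 1) t - chebL m t := by
  simp [chebL, Polynomial.Chebyshev.C_add_two]

theorem chebU_zero (t : k) : chebU 0 t = 1 := by simp [chebU]

theorem chebU_one (t : k) : chebU 1 t = t := by simp [chebU]

theorem chebU_add_two (m : ℕ) (t : k) :
    chebU (m + 2) t = t * chebU (m + 1) t - chebU m t := by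
  simp [chebU, Polynomial.Chebyshev.S_add_two]

/-- Both sides satisfy the same recurrence. This lets the coefficients `yCoeff` use one formula for
all `m ≥ 1`. -/
theorem chebL_eq_chebU_sub (t : k) (m : ℕ) : chebL (m + 2) t = chebU (m + 2) t - chebU m t := by
  induction m using Nat.twoStepInduction with
  | zero => rw [chebL_add_two, chebU_add_two, zero_add, chebL_one, chebL_zero, chebU_one,
      chebU_zero]; ring
  | one => rw [chebL_add_two, chebL_add_two, chebU_add_two, chebU_add_two, zero_add, chebL_one,
      chebL_zero, chebU_one, chebU_zero]; ring
  | more m h1 h2 =>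
    rw [chebL_add_two, chebU_add_two (m + 2), h1, show m + 2 + 1 = m + 1 + 2 from rfl, h2,
      chebU_add_two m]
    ring

theorem chebL_add_inv {Q : k} (hQ : Q ≠ 0) (m : ℕ) : chebL m (Q + Q⁻¹) = Q ^ m + (Q ^ m)⁻¹ := by
  induction m using Nat.twoStepInduction with
  | zero => rw [chebL_zero]; norm_num
  | one => rw [chebL_one, pow_one]
  | more m h1 h2 =>
    rw [chebL_add_two, h1, h2]
    field_simp
    ring

/-- Multiplying out the denominator avoids assuming `Q ≠ Q⁻¹`; with `Q^n = 1` it yields `U_{n-1} =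
0` once that factor is nonzero. -/
theorem sub_inv_mul_chebU {Q : k} (hQ : Q ≠ 0) (m : ℕ) :
    (Q - Q⁻¹) * chebU m (Q + Q⁻¹) = Q ^ (m + 1) - (Q ^ (m + 1))⁻¹ := by
  induction m using Nat.twoStepInduction with
  | zero => rw [chebU_zero]; simp
  | one => rw [chebU_one]; field_simp; ring
  | more m h1 h2 =>
    rw [chebU_add_two, mul_sub, mul_left_comm, h1, h2]
    field_simp
    ring

/-- The coefficients of the blocks `w_m`. -/
noncomputable def wCoeff (R t : k) : ℕ → k
  | 0 => 1
  | m + 1 => R ^ (m + 1) * chebL (m + 1) t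

/-- The coefficients of the blocks `y_m`. -/
noncomputable def yCoeff (R t : k) : ℕ → k
  | 0 => 1
  | m + 1 => R ^ (m + 1) * chebL (m + 1) t + ((m + 1 : ℕ) : k) * R ^ m * chebU m t

variable {n : ℕ} (q : k) (j : ℕ) (r : ZMod n) (w : ZMod n → k)

theorem wBlock_eq :
    wBlock q j r w = fun m => wCoeff (q ^ r.val) (q ^ j + (q ^ j)⁻¹) m • w := by
  ext m : 1
  rcases m with _ | m
  · rw [wCoeff, one_smul]; rfl
  · rw [wCoeff, wBlock, ← pow_mul, mul_comm r.val]

theorem yBlock_eq :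
    yBlock q j r w = fun m => yCoeff (q ^ r.val) (q ^ j + (q ^ j)⁻¹) m • w := by
  ext m : 1
  rcases m with _ | _ | m
  · rw [yCoeff, one_smul]; rfl
  · rw [yCoeff, yBlock, add_smul, zero_add, chebL_one, chebU_one, chebU_zero]
    simp
  · rw [yCoeff, yBlock, add_smul, ← pow_mul, ← pow_mul, mul_comm r.val, mul_comm r.val,
      chebL_eq_chebU_sub]

theorem revBlocks_wBlock_ne_zero [NeZero n] (hw : w ≠ 0) : revBlocks (wBlock q j r w) ≠ 0 := by
  intro h
  refine hw (funext fun s => ?_)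
  have hn := NeZero.pos n
  have := congrFun h (⟨n - 1, by omega⟩, s)
  simpa [revBlocks, wBlock] using this

variable {q r w}

/-- All but one of the block equations are the recurrence for `L_m` scaled by powers of `R`; the
remaining one is `R^n L_n = 2`. -/
theorem wBlock_vecMul_blockMatrix [NeZero n] (hn : 3 ≤ n) (hq : IsPrimitiveRoot q n)
    (hw : w ᵥ* cyclicMatrix k n = q ^ (2 * r.val) • w) :
    revBlocks (wBlock q j r w) ᵥ* blockMatrix k n =
      eigenval q j r • revBlocks (wBlock q j r w) := by
  have hQ : q ^ j ≠ 0 := pow_ne_zero _ (hq.ne_zero (by omega))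
  have hL := chebL_add_inv hQ n
  rw [← pow_mul, mul_comm j n, pow_mul, hq.pow_eq_one, one_pow] at hL
  have hR : (q ^ r.val) ^ n = 1 := by rw [← pow_mul, mul_comm, pow_mul, hq.pow_eq_one, one_pow]
  rw [mul_comm, pow_mul] at hw
  rw [wBlock_eq, eigenval]
  obtain ⟨p, rfl⟩ : ∃ p, n = p + 3 := ⟨n - 3, by omega⟩
  set R := q ^ r.val
  set t := q ^ j + (q ^ j)⁻¹
  rw [show p + 3 = p + 1 + 2 from rfl, chebL_add_two] at hL
  rw [revBlocks_vecMul_blockMatrix hn hw (δ := fun _ => 0) (ν := R * t)]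
  · ext x; simp [revBlocks]
  · simp [wCoeff, chebL_one]
  · simp only [wCoeff, chebL_add_two, zero_add, chebL_one, chebL_zero]
    ring
  · intro m
    simp only [wCoeff, chebL_add_two (m + 1)]
    ring
  · rw [show p + 3 - 2 = p + 1 by omega, show p + 3 - 1 = p + 2 by omega]
    simp only [wCoeff]
    linear_combination (-R ^ (p + 3)) * hL - 2 * hR

/-- The same recurrence with inhomogeneous term `w`. The bounds `0 < 2j < n` make `q^(2j) ≠ 1`, so
`U_{n-1} = 0`, which is what closes the extra term. -/
theorem yBlock_vecMul_blockMatrix [NeZero n] (hn : 3 ≤ n) (hq : IsPrimitiveRoot q n)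
    (hw : w ᵥ* cyclicMatrix k n = q ^ (2 * r.val) • w) (hj1 : 1 ≤ j) (hj : 2 * j < n) :
    revBlocks (yBlock q j r w) ᵥ* blockMatrix k n =
      eigenval q j r • revBlocks (yBlock q j r w) + revBlocks (wBlock q j r w) := by
  have hQ : q ^ j ≠ 0 := pow_ne_zero _ (hq.ne_zero (by omega))
  have hQn : (q ^ j) ^ n = 1 := by rw [← pow_mul, mul_comm j n, pow_mul, hq.pow_eq_one, one_pow]
  have hQQ : q ^ j - (q ^ j)⁻¹ ≠ 0 := by
    intro h
    refine hq.pow_ne_one_of_pos_of_lt (l := 2 * j) (by omega) hj ?_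
    rw [two_mul, pow_add]
    nth_rw 2 [sub_eq_zero.1 h]
    exact mul_inv_cancel₀ hQ
  have hL := chebL_add_inv hQ n
  have hU := sub_inv_mul_chebU hQ (n - 1)
  rw [Nat.sub_add_cancel (by omega), hQn, inv_one, sub_self] at hU
  replace hU := (mul_eq_zero.1 hU).resolve_left hQQ
  rw [hQn] at hL
  have hR : (q ^ r.val) ^ n = 1 := by rw [← pow_mul, mul_comm, pow_mul, hq.pow_eq_one, one_pow]
  rw [mul_comm, pow_mul] at hw
  rw [yBlock_eq, wBlock_eq, eigenval]
  obtain ⟨p, rfl⟩ : ∃ p, n = p + 3 := ⟨n - 3, by omega⟩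
  set R := q ^ r.val
  set t := q ^ j + (q ^ j)⁻¹
  rw [show p + 3 = p + 1 + 2 from rfl, chebL_add_two] at hL
  rw [show p + 3 - 1 = p + 2 by omega] at hU
  rw [revBlocks_vecMul_blockMatrix hn hw (δ := wCoeff R t) (ν := R * t)]
  · simp [yCoeff, wCoeff, chebL_one, chebU_zero]
  · simp only [yCoeff, wCoeff, chebL_add_two, zero_add, chebL_one, chebL_zero, chebU_one,
      chebU_zero]
    push_cast
    ring
  · intro m
    simp only [yCoeff, wCoeff]
    rw [chebL_add_two (m + 1), chebL_eq_chebU_sub, chebU_add_two]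
    push_cast
    ring
  · rw [show p + 3 - 2 = p + 1 by omega, show p + 3 - 1 = p + 2 by omega]
    have hU' := chebL_eq_chebU_sub t p
    have hU'' := chebU_add_two p t
    rw [hU] at hU' hU''
    simp only [yCoeff, wCoeff]
    push_cast
    -- The first two terms close the `w` part as before. With `U_{n-1} = 0`, the others use `L_{n-1}
    -- = -U_{n-3}` and `t U_{n-2} = U_{n-3}`, so the terms in `U_{n-3}` cancel.
    linear_combination (-R ^ (p + 3)) * hL - 2 * hR - R ^ (p + 2) * hU' +
      (p + 2) * R ^ (p + 2) * hU''

end Eigenvectors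

end TaftDouble

theorem proposition3p9 {k : Type*} [Field k] [IsAlgClosed k] [CharZero k]
    (n : ℕ) [NeZero n] (hn : 3 ≤ n) (hodd : Odd n) (q : k) (hq : IsPrimitiveRoot q n)
    (r : ZMod n) (w₀ : ZMod n → k)
    (hw₀ : IsLeftEigenvector (cyclicMatrix k n) (q ^ (2 * r.val)) w₀) :
    mckayMatrixTwo hq (Nat.lt_of_lt_of_le (by decide) hn) = blockMatrix k n ∧
    (∀ j : ℕ, j ≤ (n - 1) / 2 →
      (∀ m : ℕ, 1 ≤ m → m ≤ n - 1 →
        wBlock q j r w₀ m = (q ^ (m * r.val) * (q ^ (m * j) + (q ^ (m * j))⁻¹)) • w₀) ∧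
      IsLeftEigenvector (mckayMatrixTwo hq (Nat.lt_of_lt_of_le (by decide) hn))
        (eigenval q j r) (revBlocks (wBlock q j r w₀))) ∧
    (∀ j : ℕ, 1 ≤ j → j ≤ (n - 1) / 2 →
      IsGeneralizedLeftEigenvector (mckayMatrixTwo hq (Nat.lt_of_lt_of_le (by decide) hn))
        (eigenval q j r) (revBlocks (yBlock q j r w₀)) ∧
      revBlocks (yBlock q j r w₀) ᵥ* mckayMatrixTwo hq (Nat.lt_of_lt_of_le (by decide) hn) =
        eigenval q j r • revBlocks (yBlock q j r w₀) + revBlocks (wBlock q j r w₀)) := by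
  have hM := mckayMatrixTwo_eq_blockMatrix hq (Nat.lt_of_lt_of_le (by decide) hn) hn
  rw [hM]
  have hW : ∀ j, IsLeftEigenvector (blockMatrix k n) (eigenval q j r)
      (revBlocks (wBlock q j r w₀)) := fun j =>
    ⟨revBlocks_wBlock_ne_zero q j r w₀ hw₀.1, wBlock_vecMul_blockMatrix j hn hq hw₀.2⟩
  refine ⟨rfl, fun j _ => ⟨fun m hm _ => ?_, hW j⟩, fun j hj1 hj => ?_⟩
  · obtain ⟨m, rfl⟩ : ∃ m', m = m' + 1 := ⟨m - 1, by omega⟩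
    rw [wBlock, chebL_add_inv (pow_ne_zero _ (hq.ne_zero (by omega))), ← pow_mul,
      mul_comm j (m + 1)]
  · have hY := yBlock_vecMul_blockMatrix j hn hq hw₀.2 hj1 (by omega)
    refine ⟨?_, hY⟩
    -- The relation `y M = λ y + w` says that `y (M - λ)` is exactly the eigenvector `w` of part
    -- (a).
    rw [IsGeneralizedLeftEigenvector, Matrix.vecMul_sub, Matrix.vecMul_smul, Matrix.vecMul_one,
      hY, add_sub_cancel_left]
    exact hW j
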